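/- For a complex vector space $X$ let $M_m(X)$ be the space of $m\times m$ matrices over $X$; scalar matrices carry the operator norm, and $w$ denotes the numerical radius of a bounded Hilbert space operator. An operator space is a pair $(X,\mathcal O)$ with norms $\mathcal O_m$ on $M_m(X)$, $m\ge 1$, such that $\mathcal O_{m+n}(x\oplus y)=\max\{\mathcal O_m(x),\mathcal O_n(y)\}$ and $\mathcal O_n(\alpha x\beta)\le\|\alpha\|\,\mathcal O_m(x)\,\|\beta\|$ for all $x\in M_m(X)$, $y\in M_n(X)$ and scalar matrices $\alpha\in M_{n,m}(\mathbb C)$, $\beta\in M_{m,n}(\mathbb C)$. A numerical radius norm affiliated with $(X,\mathcal O)$ is a sequence $\mathcal W=(\mathcal W_m)$ of norms on the spaces $M_m(X)$ such that $\mathcal W_{m+n}(x\oplus y)=\max\{\mathcal W_m(x),\mathcal W_n(y)\}$, $\mathcal W_n(\alpha x\alpha^*)\le\|\alpha\|^2\mathcal W_m(x)$ and $\mathcal W_{2m}\begin{pmatrix}0&x\\0&0\end{pmatrix}=\tfrac12\mathcal O_m(x)$, for all $x,y,\alpha$ as above. For $x\in M_m(X)$ put $\mathcal W_{\min}(x)=\tfrac12\mathcal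 O_m(x)$ and $$\mathcal W_{\max}(x)=\inf\left\{\tfrac12\|aa^*+b^*b\| : x=ayb,\ a\in M_{m,r}(\mathbb C),\ y\in M_r(X),\ b\in M_{r,m}(\mathbb C),\ r\in\mathbb N,\ \mathcal O_r(y)=1\right\}$$ (read as $0$ if $X=0$). Let $(X,\mathcal O)$ be an operator space and $n\ge 3$. Then there are a Hilbert space $H$ and a linear map $\Phi_{\max}:X\to B(H)$ with $\|[\Phi_{\max}(x_{ij})]\|=\mathcal O_m(x)$ and $w([\Phi_{\max}(x_{ij})])=\mathcal W_{\max}(x)$ for all $x=[x_{ij}]\in M_m(X)$ and all $m$. Fix any such $H$ and $\Phi_{\max}$. For $t\in[0,1]$ let $a_t\in M_n(\mathbb C)$ be the weighted shift with first superdiagonal $(1,t,\dots,t)$ and all other entries $0$, let $\Phi_t(x)=\Phi_{\max}(x)\otimes a_t\in B(H)\otimes M_n(\mathbb C)=B(H^n)$, and put $\mathcal W_t(x)=w([\Phi_t(x_{ij})])$ for $x=[x_{ij}]\in M_m(X)$. Then: 1. for every $t\in[0,1]$, $\|a_t\|=1$, $\Phi_t$ is completely isometric (that is, $\|[\Phi_t(x_{ij})]\|=\mathcal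 O_m(x)$ for all $m$ and all $x\in M_m(X)$), and $\mathcal W_t$ is a numerical radius norm affiliated with $(X,\mathcal O)$; 2. $\mathcal W_0=\mathcal W_{\min}$; 3. $\cos\left(\frac{\pi}{n+1}\right)\mathcal W_{\max}(x)\le\mathcal W_1(x)\le\mathcal W_{\max}(x)$ for all $m$ and $x\in M_m(X)$; 4. for all $m$ and $x\in M_m(X)$ the function $t\mapsto\mathcal W_t(x)$ is continuous on $[0,1]$; 5. if $X\ne 0$, then the set $\{\mathcal W_t : 0\le t\le 1\}$ is uncountable; 6. if $a_t$ is replaced by $b_t=\begin{pmatrix}0&\sqrt{1-t}\\0&\sqrt t\end{pmatrix}\in M_2(\mathbb C)$, then the resulting $\mathcal W_t$, $t\in[0,1]$, are again numerical radius norms affiliated with $(X,\mathcal O)$, $t\mapsto\mathcal W_t(x)$ is again continuous on $[0,1]$ for every $x\in M_m(X)$, and the family is again uncountable if $X\ne0$. In particular, if $X\neq 0$, there are uncountably many numerical radius norms affiliated with $(X,\mathcal O)$. -/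

import Mathlib

open scoped Matrix.Norms.L2Operator

noncomputable section

namespace NumRad

/-! Matrices of scalars carry the operator norm between Euclidean spaces. Matrix spaces are indexed
by all `m : ℕ`; the space of `0 × 0` matrices is the zero space and adds no information. -/

section Abstract

variable {X : Type*} [AddCommGroup X] [Module ℂ X]

/-- A family of real valued functions on the matrix spaces `M_m(X)`, one for each size `m`. -/
abbrev MatFun (X : Type*) : Type _ := ∀ m : ℕ, Matrix (Fin m) (Fin m) X → ℝ

/-- The product `α x β` of a matrix `x` over `X` by scalar matrices from both sides. -/
def sandwich {k l p q : ℕ} (α : Matrix (Fin k) (Fin l) ℂ) (x : Matrix (Fin l) (Fin p) X)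
    (β : Matrix (Fin p) (Fin q) ℂ) : Matrix (Fin k) (Fin q) X :=
  Matrix.of fun i j => ∑ s, ∑ t, (α i s * β t j) • x s t

/-- The block diagonal matrix `[[x, 0], [0, y]]`. -/
def diagBlock {m n : ℕ} (x : Matrix (Fin m) (Fin m) X) (y : Matrix (Fin n) (Fin n) X) :
    Matrix (Fin (m + n)) (Fin (m + n)) X :=
  Matrix.reindex finSumFinEquiv finSumFinEquiv (Matrix.fromBlocks x 0 0 y)

/-- The block matrix `[[0, x], [0, 0]]`. -/
def cornerBlock {m : ℕ} (x : Matrix (Fin m) (Fin m) X) :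
    Matrix (Fin (m + m)) (Fin (m + m)) X :=
  Matrix.reindex finSumFinEquiv finSumFinEquiv (Matrix.fromBlocks 0 x 0 0)

/-- Every `N m` is a norm on the complex vector space `M_m(X)`. -/
structure IsNormFamily (N : MatFun X) : Prop where
  add_le : ∀ (m : ℕ) (x y : Matrix (Fin m) (Fin m) X), N m (x + y) ≤ N m x + N m y
  smul_eq : ∀ (m : ℕ) (c : ℂ) (x : Matrix (Fin m) (Fin m) X), N m (c • x) = ‖c‖ * N m x
  definite : ∀ (m : ℕ) (x : Matrix (Fin m) (Fin m) X), N m x = 0 → x = 0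

/-- Ruan's axioms: `(X, O)` is an abstract operator space. -/
structure IsOperatorSpace (O : MatFun X) : Prop where
  isNorm : IsNormFamily O
  diag_eq : ∀ (m n : ℕ) (x : Matrix (Fin m) (Fin m) X) (y : Matrix (Fin n) (Fin n) X),
    O (m + n) (diagBlock x y) = max (O m x) (O n y)
  sandwich_le : ∀ (m n : ℕ) (α : Matrix (Fin n) (Fin m) ℂ) (x : Matrix (Fin m) (Fin m) X)
    (β : Matrix (Fin m) (Fin n) ℂ), O n (sandwich α x β) ≤ ‖α‖ * O m x * ‖β‖

/-- `(X, W)` is an abstract numerical radius operator space. -/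
structure IsNumericalRadiusSpace (W : MatFun X) : Prop where
  isNorm : IsNormFamily W
  diag_eq : ∀ (m n : ℕ) (x : Matrix (Fin m) (Fin m) X) (y : Matrix (Fin n) (Fin n) X),
    W (m + n) (diagBlock x y) = max (W m x) (W n y)
  conj_le : ∀ (m n : ℕ) (α : Matrix (Fin n) (Fin m) ℂ) (x : Matrix (Fin m) (Fin m) X),
    W n (sandwich α x α.conjTranspose) ≤ ‖α‖ ^ 2 * W m x

/-- `W` is a numerical radius norm affiliated with the operator space `(X, O)`. -/
structure IsAffiliated (O W : MatFun X) : Prop where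
  isNumericalRadius : IsNumericalRadiusSpace W
  corner_eq : ∀ (m : ℕ) (x : Matrix (Fin m) (Fin m) X),
    (1 / 2 : ℝ) * O m x = W (m + m) (cornerBlock x)

/-- The maximal numerical radius norm: the infimum of `‖a a* + b* b‖ / 2` over all
factorizations `x = a y b` with `O y = 1`. (If `X = 0` there are none, and the value is `0`.) -/
def Wmax (O : MatFun X) : MatFun X := fun m x =>
  sInf {s : ℝ | ∃ (r : ℕ) (a : Matrix (Fin m) (Fin r) ℂ) (y : Matrix (Fin r) (Fin r) X)
    (b : Matrix (Fin r) (Fin m) ℂ), x = sandwich a y b ∧ O r y = 1 ∧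
      s = 1 / 2 * ‖a * a.conjTranspose + b.conjTranspose * b‖}

/-- The minimal numerical radius norm. -/
def Wmin (O : MatFun X) : MatFun X := fun m x => 1 / 2 * O m x

end Abstract

section Concrete

variable {H : Type*} [NormedAddCommGroup H] [InnerProductSpace ℂ H]

/-- The numerical radius of a bounded operator. -/
def numRadius (T : H →L[ℂ] H) : ℝ :=
  sSup {s : ℝ | ∃ ξ : H, ‖ξ‖ = 1 ∧ s = ‖inner ℂ ξ (T ξ)‖}

/-- The Hilbert space direct sum `H^m`. -/
abbrev HPow (m : ℕ) (H : Type*) : Type _ := PiLp 2 (fun _ : Fin m => H)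

/-- The identification of a matrix of operators on `H` with an operator on `H^m`. -/
def blockOp {m : ℕ} (A : Matrix (Fin m) (Fin m) (H →L[ℂ] H)) : HPow m H →L[ℂ] HPow m H :=
  ((PiLp.continuousLinearEquiv 2 ℂ (fun _ : Fin m => H)).symm : (Fin m → H) →L[ℂ] HPow m H) ∘L
    ContinuousLinearMap.pi fun i => ∑ j, A i j ∘L PiLp.proj 2 (fun _ : Fin m => H) j

theorem blockOp_apply {m : ℕ} (A : Matrix (Fin m) (Fin m) (H →L[ℂ] H)) (ξ : HPow m H)
    (i : Fin m) : blockOp A ξ i = ∑ j, A i j (ξ j) := by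
  simp [blockOp]

/-- The map `T ↦ T ⊗ a` from `B(H)` to `B(H) ⊗ M_n(ℂ) = M_n(B(H)) = B(H^n)`: the operator `T ⊗ a`
has the matrix `[a i j • T]`. -/
def tensorRight {n : ℕ} (a : Matrix (Fin n) (Fin n) ℂ) :
    (H →L[ℂ] H) →ₗ[ℂ] (HPow n H →L[ℂ] HPow n H) where
  toFun T := blockOp (Matrix.of fun i j => a i j • T)
  map_add' S T := by
    ext ξ i
    simp [blockOp_apply, Finset.sum_add_distrib]
  map_smul' c T := by
    ext ξ i
    simp [blockOp_apply, Finset.smul_sum, smul_comm c]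

variable {X : Type*} [AddCommGroup X] [Module ℂ X]

/-- The operator norms of the amplifications of `Φ`. -/
def opNormFun (Φ : X →ₗ[ℂ] (H →L[ℂ] H)) : MatFun X := fun _ x => ‖blockOp (x.map Φ)‖

/-- The numerical radii of the amplifications of `Φ`. -/
def numRadiusFun (Φ : X →ₗ[ℂ] (H →L[ℂ] H)) : MatFun X := fun _ x => numRadius (blockOp (x.map Φ))

/-- `Φ` is a complete isometry from `(X, O)` into `B(H)`. -/
def IsCompleteIsometry (O : MatFun X) (Φ : X →ₗ[ℂ] (H →L[ℂ] H)) : Prop :=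
  ∀ (m : ℕ) (x : Matrix (Fin m) (Fin m) X), opNormFun Φ m x = O m x

/-- `Φ` is a `W`-complete isometry from `(X, W)` into `B(H)` with the numerical radius norms. -/
def IsWCompleteIsometry (W : MatFun X) (Φ : X →ₗ[ℂ] (H →L[ℂ] H)) : Prop :=
  ∀ (m : ℕ) (x : Matrix (Fin m) (Fin m) X), numRadiusFun Φ m x = W m x

/-- The `n × n` weighted shift with weights `1, t, …, t` on the first superdiagonal. -/
def shiftMat (n : ℕ) (t : ℝ) : Matrix (Fin n) (Fin n) ℂ :=
  Matrix.of fun i j =>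
    if i.val + 1 = j.val then (if i.val = 0 then 1 else (t : ℂ)) else 0

/-- The `2 × 2` matrix `[[0, √(1 - t)], [0, √t]]`. -/
def cornerMat (t : ℝ) : Matrix (Fin 2) (Fin 2) ℂ :=
  !![0, (Real.sqrt (1 - t) : ℂ); 0, (Real.sqrt t : ℂ)]

/-- The linear map `x ↦ Φ(x) ⊗ a` from `X` into `B(H^n)`. -/
def tensorMap {n : ℕ} (Φ : X →ₗ[ℂ] (H →L[ℂ] H)) (a : Matrix (Fin n) (Fin n) ℂ) :
    X →ₗ[ℂ] (HPow n H →L[ℂ] HPow n H) :=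
  tensorRight a ∘ₗ Φ

/-- The family `x ↦ w([Φ(x i j) ⊗ a])` of functions on the matrix spaces. -/
def tensorNorm {n : ℕ} (Φ : X →ₗ[ℂ] (H →L[ℂ] H)) (a : Matrix (Fin n) (Fin n) ℂ) : MatFun X :=
  numRadiusFun (tensorMap Φ a)

end Concrete

end NumRad

end

universe u v

/-! Two facts about a linear map `Φ` into `B(H)` drive everything. A complete isometry always
induces an affiliated norm, because the numerical radius of a corner block is half the operator
norm. And a complete contraction always stays below `Wmax`: for `x = a y b` the form `⟨ξ, a Φ(y) b
ξ⟩` is at most `½ (‖a* ξ‖² + ‖b ξ‖²)` when `O y = 1`.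

Existence of the maximal representation is a separation argument. If `c < Wmax x₀`, the Riesz
extension theorem on a cone of factorizations gives a functional `f` with `c ≤ |f x₀|` and a
positive `p` with `|f (a y b)| ≤ ½ O(y) p(aa* + b*b)` (`exists_functionals`). Writing `p`, up to
`ε`, as `q* q` and conjugating the form of `f` by `q⁻¹` yields a complete contraction into `B(ℂᵐ)`
that nearly attains `c` (`exists_isCompleteContraction_le_numRadiusFun`). The direct sum of all such
maps attains `Wmax`; evaluating it on corner blocks shows that it is also completely isometric, so
no prior representation theorem for operator spaces is needed.

For the paths, tensoring with a matrix of norm one keeps complete isometry, since a unit vector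
attains that norm. At `t = 0` the matrix is a single off-diagonal unit and the norm is `Wmin`. At `t
= 1` a sine vector yields the factor `cos (π / (n + 1))`, which exceeds `1 / 2` for `n ≥ 3`. As
`Wmax ≥ O` on `1 × 1` matrices, the endpoint values differ there, and the intermediate value theorem
gives uncountably many norms. -/

noncomputable section

open scoped MatrixOrder ComplexOrder

namespace NumRad

/-! ### The numerical radius as a norm equivalent to the operator norm -/

section NumericalRadius

variable {H : Type*} [NormedAddCommGroup H] [InnerProductSpace ℂ H]

theorem norm_inner_map_self_le (T : H →L[ℂ] H) (ξ : H) : ‖inner ℂ ξ (T ξ)‖ ≤ ‖T‖ * ‖ξ‖ ^ 2 :=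
  calc ‖inner ℂ ξ (T ξ)‖ ≤ ‖ξ‖ * ‖T ξ‖ := norm_inner_le_norm _ _
    _ ≤ ‖ξ‖ * (‖T‖ * ‖ξ‖) := by gcongr; exact T.le_opNorm ξ
    _ = ‖T‖ * ‖ξ‖ ^ 2 := by ring

theorem bddAbove_numericalRange (T : H →L[ℂ] H) :
    BddAbove {s : ℝ | ∃ ξ : H, ‖ξ‖ = 1 ∧ s = ‖inner ℂ ξ (T ξ)‖} := by
  refine ⟨‖T‖, ?_⟩
  rintro s ⟨ξ, hξ, rfl⟩
  simpa [hξ] using norm_inner_map_self_le T ξ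

theorem numRadius_nonneg (T : H →L[ℂ] H) : 0 ≤ numRadius T := by
  apply Real.sSup_nonneg
  rintro s ⟨ξ, -, rfl⟩
  exact norm_nonneg _

theorem norm_inner_le_numRadius (T : H →L[ℂ] H) (ξ : H) :
    ‖inner ℂ ξ (T ξ)‖ ≤ numRadius T * ‖ξ‖ ^ 2 := by
  by_cases h : ξ = 0
  · simp [h]
  have hpos : 0 < ‖ξ‖ := norm_pos_iff.2 h
  have hle : ‖inner ℂ (((‖ξ‖⁻¹ : ℝ) : ℂ) • ξ) (T (((‖ξ‖⁻¹ : ℝ) : ℂ) • ξ))‖ ≤ numRadius T := by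
    refine le_csSup (bddAbove_numericalRange T) ⟨_, ?_, rfl⟩
    rw [norm_smul, Complex.norm_real, norm_inv, norm_norm, inv_mul_cancel₀ hpos.ne']
  rw [map_smul, inner_smul_left, inner_smul_right, norm_mul, norm_mul, RCLike.norm_conj,
    Complex.norm_real, norm_inv, norm_norm] at hle
  calc ‖inner ℂ ξ (T ξ)‖ = (‖ξ‖⁻¹ * (‖ξ‖⁻¹ * ‖inner ℂ ξ (T ξ)‖)) * ‖ξ‖ ^ 2 := by field_simp
    _ ≤ numRadius T * ‖ξ‖ ^ 2 := by gcongr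

theorem numRadius_le {T : H →L[ℂ] H} {c : ℝ} (hc : 0 ≤ c)
    (h : ∀ ξ, ‖inner ℂ ξ (T ξ)‖ ≤ c * ‖ξ‖ ^ 2) : numRadius T ≤ c := by
  refine Real.sSup_le ?_ hc
  rintro s ⟨ξ, hξ, rfl⟩
  simpa [hξ] using h ξ

theorem numRadius_le_opNorm (T : H →L[ℂ] H) : numRadius T ≤ ‖T‖ :=
  numRadius_le (norm_nonneg T) (norm_inner_map_self_le T)

theorem numRadius_add_le (S T : H →L[ℂ] H) : numRadius (S + T) ≤ numRadius S + numRadius T := by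
  refine numRadius_le (add_nonneg (numRadius_nonneg S) (numRadius_nonneg T)) fun ξ => ?_
  rw [add_apply, inner_add_right, add_mul]
  exact (norm_add_le _ _).trans
    (add_le_add (norm_inner_le_numRadius S ξ) (norm_inner_le_numRadius T ξ))

theorem numRadius_smul_le (c : ℂ) (T : H →L[ℂ] H) : numRadius (c • T) ≤ ‖c‖ * numRadius T := by
  refine numRadius_le (mul_nonneg (norm_nonneg c) (numRadius_nonneg T)) fun ξ => ?_
  rw [smul_apply, inner_smul_right, norm_mul, mul_assoc]
  gcongr
  exact norm_inner_le_numRadius T ξ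

theorem numRadius_smul (c : ℂ) (T : H →L[ℂ] H) : numRadius (c • T) = ‖c‖ * numRadius T := by
  refine le_antisymm (numRadius_smul_le c T) ?_
  by_cases hc : c = 0
  · simpa [hc] using numRadius_nonneg (0 : H →L[ℂ] H)
  have h := numRadius_smul_le c⁻¹ (c • T)
  rw [smul_smul, inv_mul_cancel₀ hc, one_smul, norm_inv] at h
  have hpos : 0 < ‖c‖ := norm_pos_iff.2 hc
  calc ‖c‖ * numRadius T ≤ ‖c‖ * (‖c‖⁻¹ * numRadius (c • T)) := by gcongr
    _ = numRadius (c • T) := by field_simp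

/-- Polarization writes the form as a quarter of four quadratic values at `η ± ξ` and `η ± iξ`; two
parallelogram laws add the four squared norms up to `4 (‖η‖² + ‖ξ‖²)`. -/
theorem norm_inner_map_le_numRadius (T : H →L[ℂ] H) (ξ η : H) :
    ‖inner ℂ η (T ξ)‖ ≤ numRadius T * (‖η‖ ^ 2 + ‖ξ‖ ^ 2) := by
  have key (v : H) : ‖inner ℂ (T v) v‖ ≤ numRadius T * ‖v‖ ^ 2 := by
    rw [norm_inner_symm]; exact norm_inner_le_numRadius T v
  have hI : ‖Complex.I • ξ‖ = ‖ξ‖ := by rw [norm_smul, Complex.norm_I, one_mul]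
  have p1 := parallelogram_law_with_norm ℂ η ξ
  have p2 := parallelogram_law_with_norm ℂ η (Complex.I • ξ)
  rw [hI] at p2
  have hpol := inner_map_polarization (T : H →ₗ[ℂ] H) η ξ
  simp only [ContinuousLinearMap.coe_coe] at hpol
  rw [norm_inner_symm, hpol, norm_div]
  have h4 : ‖(4 : ℂ)‖ = 4 := by simp
  rw [h4, div_le_iff₀ (by norm_num)]
  refine (norm_sub_le _ _).trans ?_
  refine (add_le_add_left (norm_add_le _ _) _).trans ?_
  refine (add_le_add_left (add_le_add_left (norm_sub_le _ _) _) _).trans ?_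
  rw [norm_mul, norm_mul, Complex.norm_I, one_mul, one_mul]
  have k1 := key (η + ξ)
  have k2 := key (η - ξ)
  have k3 := key (η + Complex.I • ξ)
  have k4 := key (η - Complex.I • ξ)
  have e : numRadius T * (‖η‖ ^ 2 + ‖ξ‖ ^ 2) * 4 = numRadius T * ‖η + ξ‖ ^ 2
      + numRadius T * ‖η - ξ‖ ^ 2 + numRadius T * ‖η + Complex.I • ξ‖ ^ 2
      + numRadius T * ‖η - Complex.I • ξ‖ ^ 2 := by
    linear_combination (-numRadius T) * p1 + (-numRadius T) * p2
  rw [e]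
  linarith

theorem opNorm_le_two_mul {K : Type*} [NormedAddCommGroup K] [InnerProductSpace ℂ K]
    {T : H →L[ℂ] K} {c : ℝ} (hc : 0 ≤ c)
    (h : ∀ ξ η, ‖inner ℂ η (T ξ)‖ ≤ c * (‖η‖ ^ 2 + ‖ξ‖ ^ 2)) : ‖T‖ ≤ 2 * c := by
  refine T.opNorm_le_bound (by positivity) fun ξ => ?_
  by_cases hT : T ξ = 0
  · rw [hT, norm_zero]; positivity
  have hpos : 0 < ‖T ξ‖ := norm_pos_iff.2 hT
  have hξ : 0 < ‖ξ‖ := norm_pos_iff.2 fun h0 => hT (by rw [h0, map_zero])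
  -- Rescaling `T ξ` to the length of `ξ` makes the two squares equal, so the additive bound loses
  -- nothing against the product `‖η‖ ‖ξ‖`.
  have h1 := h ξ (((‖ξ‖ / ‖T ξ‖ : ℝ) : ℂ) • T ξ)
  rw [inner_smul_left, norm_mul, RCLike.norm_conj, norm_smul, Complex.norm_real,
    Real.norm_of_nonneg (by positivity), div_mul_cancel₀ _ hpos.ne', inner_self_eq_norm_sq_to_K,
    norm_pow] at h1
  have e : ‖((‖T ξ‖ : ℝ) : ℂ)‖ = ‖T ξ‖ := by simp
  have h2 : ‖ξ‖ * ‖T ξ‖ ≤ ‖ξ‖ * (2 * c * ‖ξ‖) := by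
    calc ‖ξ‖ * ‖T ξ‖ = ‖ξ‖ / ‖T ξ‖ * ‖T ξ‖ ^ 2 := by field_simp
      _ ≤ c * (‖ξ‖ ^ 2 + ‖ξ‖ ^ 2) := by simpa using h1
      _ = ‖ξ‖ * (2 * c * ‖ξ‖) := by ring
  exact le_of_mul_le_mul_left h2 hξ

theorem opNorm_le_two_mul_numRadius (T : H →L[ℂ] H) : ‖T‖ ≤ 2 * numRadius T :=
  opNorm_le_two_mul (numRadius_nonneg T) (norm_inner_map_le_numRadius T)

theorem continuous_numRadius : Continuous (numRadius : (H →L[ℂ] H) → ℝ) := by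
  refine LipschitzWith.continuous (K := 1) (LipschitzWith.of_le_add fun S T => ?_)
  have h := numRadius_add_le T (S - T)
  rw [add_sub_cancel] at h
  rw [dist_eq_norm]
  linarith [numRadius_le_opNorm (S - T)]

end NumericalRadius

/-! ### Scalar matrices acting on powers of a Hilbert space -/

section Amplification

variable {H : Type*} [NormedAddCommGroup H] [InnerProductSpace ℂ H]

/-- The action of a scalar matrix on the powers of a Hilbert space. -/
def amp {k l : ℕ} (a : Matrix (Fin k) (Fin l) ℂ) (ξ : HPow l H) : HPow k H :=
  WithLp.toLp 2 fun i => ∑ s, a i s • ξ s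

@[simp] theorem amp_apply {k l : ℕ} (a : Matrix (Fin k) (Fin l) ℂ) (ξ : HPow l H) (i : Fin k) :
    amp a ξ i = ∑ s, a i s • ξ s := rfl

theorem inner_amp_right {k l : ℕ} (a : Matrix (Fin k) (Fin l) ℂ) (ξ : HPow l H) (η : HPow k H) :
    inner ℂ η (amp a ξ) = inner ℂ (amp a.conjTranspose η) ξ := by
  simp only [PiLp.inner_apply, amp_apply, inner_sum, sum_inner, inner_smul_left, inner_smul_right,
    Matrix.conjTranspose_apply, RCLike.star_def, RingHomCompTriple.comp_apply, RingHom.id_apply]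
  exact Finset.sum_comm

theorem amp_mul {k l p : ℕ} (a : Matrix (Fin k) (Fin l) ℂ) (b : Matrix (Fin l) (Fin p) ℂ)
    (ξ : HPow p H) : amp (a * b) ξ = amp a (amp b ξ) := by
  ext i
  simp only [amp_apply, Matrix.mul_apply, Finset.sum_smul, Finset.smul_sum, smul_smul]
  exact Finset.sum_comm

theorem amp_add {k l : ℕ} (a b : Matrix (Fin k) (Fin l) ℂ) (ξ : HPow l H) :
    amp (a + b) ξ = amp a ξ + amp b ξ := by
  ext i
  simp [add_smul, Finset.sum_add_distrib]

theorem inner_amp_conjTranspose_mul_self {k l : ℕ} (a : Matrix (Fin k) (Fin l) ℂ)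
    (ξ : HPow l H) : inner ℂ ξ (amp (a.conjTranspose * a) ξ) = ((‖amp a ξ‖ ^ 2 : ℝ) : ℂ) := by
  rw [amp_mul, inner_amp_right, Matrix.conjTranspose_conjTranspose, inner_self_eq_norm_sq_to_K]
  simp

/-- The difference `b - a` factors as `c* c`, which contributes `‖c ξ‖²` to the form. This carries
the order of scalar matrices over to `H^l`. -/
theorem re_inner_amp_mono {l : ℕ} {a b : Matrix (Fin l) (Fin l) ℂ} (h : a ≤ b) (ξ : HPow l H) :
    (inner ℂ ξ (amp a ξ)).re ≤ (inner ℂ ξ (amp b ξ)).re := by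
  obtain ⟨c, hc⟩ := CStarAlgebra.nonneg_iff_eq_star_mul_self.1 (sub_nonneg.2 h)
  have hb : b = a + c.conjTranspose * c := by
    rw [← Matrix.star_eq_conjTranspose, ← hc]; abel
  rw [hb, amp_add, inner_add_right, inner_amp_conjTranspose_mul_self, Complex.add_re,
    Complex.ofReal_re]
  linarith [sq_nonneg ‖amp c ξ‖]

theorem re_inner_amp_le {l : ℕ} {a : Matrix (Fin l) (Fin l) ℂ} (ha : IsSelfAdjoint a)
    (ξ : HPow l H) : (inner ℂ ξ (amp a ξ)).re ≤ ‖a‖ * ‖ξ‖ ^ 2 := by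
  refine (re_inner_amp_mono ha.le_algebraMap_norm_self ξ).trans_eq ?_
  have : amp (algebraMap ℝ (Matrix (Fin l) (Fin l) ℂ) ‖a‖) ξ = ((‖a‖ : ℝ) : ℂ) • ξ := by
    ext i
    simp [Matrix.algebraMap_matrix_apply]
  rw [this, inner_smul_right, inner_self_eq_norm_sq_to_K, ← Complex.ofReal_re (‖a‖ * ‖ξ‖ ^ 2)]
  simp

theorem norm_amp_le {k l : ℕ} (a : Matrix (Fin k) (Fin l) ℂ) (ξ : HPow l H) :
    ‖amp a ξ‖ ≤ ‖a‖ * ‖ξ‖ := by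
  have h := re_inner_amp_le (Matrix.isHermitian_conjTranspose_mul_self a) ξ
  rw [inner_amp_conjTranspose_mul_self, Complex.ofReal_re,
    Matrix.l2_opNorm_conjTranspose_mul_self] at h
  refine (pow_le_pow_iff_left₀ (norm_nonneg _) (by positivity) two_ne_zero).1 ?_
  rwa [mul_pow, sq ‖a‖]

end Amplification

/-! ### Entries of block matrices -/

section Blocks

variable {X : Type*} [AddCommGroup X]

@[simp] theorem diagBlock_castAdd_castAdd {m n : ℕ} (x : Matrix (Fin m) (Fin m) X)
    (y : Matrix (Fin n) (Fin n) X) (i j : Fin m) :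
    diagBlock x y (Fin.castAdd n i) (Fin.castAdd n j) = x i j := by
  simp [diagBlock]

@[simp] theorem diagBlock_castAdd_natAdd {m n : ℕ} (x : Matrix (Fin m) (Fin m) X)
    (y : Matrix (Fin n) (Fin n) X) (i : Fin m) (j : Fin n) :
    diagBlock x y (Fin.castAdd n i) (Fin.natAdd m j) = 0 := by
  simp [diagBlock]

@[simp] theorem diagBlock_natAdd_castAdd {m n : ℕ} (x : Matrix (Fin m) (Fin m) X)
    (y : Matrix (Fin n) (Fin n) X) (i : Fin n) (j : Fin m) :
    diagBlock x y (Fin.natAdd m i) (Fin.castAdd n j) = 0 := by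
  simp [diagBlock]

@[simp] theorem diagBlock_natAdd_natAdd {m n : ℕ} (x : Matrix (Fin m) (Fin m) X)
    (y : Matrix (Fin n) (Fin n) X) (i j : Fin n) :
    diagBlock x y (Fin.natAdd m i) (Fin.natAdd m j) = y i j := by
  simp [diagBlock]

@[simp] theorem cornerBlock_castAdd_castAdd {m : ℕ} (x : Matrix (Fin m) (Fin m) X)
    (i j : Fin m) : cornerBlock x (Fin.castAdd m i) (Fin.castAdd m j) = 0 := by
  simp [cornerBlock, -Fin.natAdd_eq_addNat]

@[simp] theorem cornerBlock_castAdd_natAdd {m : ℕ} (x : Matrix (Fin m) (Fin m) X)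
    (i j : Fin m) : cornerBlock x (Fin.castAdd m i) (Fin.natAdd m j) = x i j := by
  simp [cornerBlock, -Fin.natAdd_eq_addNat]

@[simp] theorem cornerBlock_natAdd {m : ℕ} (x : Matrix (Fin m) (Fin m) X)
    (i : Fin m) (j : Fin (m + m)) : cornerBlock x (Fin.natAdd m i) j = 0 := by
  refine Fin.addCases (fun j => ?_) (fun j => ?_) j <;> simp [cornerBlock, -Fin.natAdd_eq_addNat]

variable [Module ℂ X]

theorem sandwich_apply {k l p q : ℕ} (α : Matrix (Fin k) (Fin l) ℂ)
    (x : Matrix (Fin l) (Fin p) X) (β : Matrix (Fin p) (Fin q) ℂ) (i : Fin k) (j : Fin q) :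
    sandwich α x β i j = ∑ s, ∑ t, (α i s * β t j) • x s t := rfl

end Blocks

/-! ### Splitting vectors of `H ^ (m + n)` -/

section Parts

variable {H : Type*}

/-- The components of a vector in `H ^ (m + n)` along the first `m` coordinates. -/
def headPart {m n : ℕ} (ξ : HPow (m + n) H) : HPow m H :=
  WithLp.toLp 2 fun i => ξ (Fin.castAdd n i)

/-- The components of a vector in `H ^ (m + n)` along the last `n` coordinates. -/
def tailPart {m n : ℕ} (ξ : HPow (m + n) H) : HPow n H :=
  WithLp.toLp 2 fun i => ξ (Fin.natAdd m i)

/-- The vector in `H ^ (m + n)` with given components in `H ^ m` and `H ^ n`. -/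
def joinParts {m n : ℕ} (ξ : HPow m H) (η : HPow n H) : HPow (m + n) H :=
  WithLp.toLp 2 (Fin.append (fun i => ξ i) (fun i => η i))

@[simp] theorem headPart_joinParts {m n : ℕ} (ξ : HPow m H) (η : HPow n H) :
    headPart (joinParts ξ η) = ξ := by
  ext i; simp [headPart, joinParts]

@[simp] theorem tailPart_joinParts {m n : ℕ} (ξ : HPow m H) (η : HPow n H) :
    tailPart (joinParts ξ η) = η := by
  ext i; simp [tailPart, joinParts]

variable [NormedAddCommGroup H]

theorem norm_sq_eq_headPart_add_tailPart {m n : ℕ} (ξ : HPow (m + n) H) :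
    ‖ξ‖ ^ 2 = ‖headPart ξ‖ ^ 2 + ‖tailPart ξ‖ ^ 2 := by
  simp [PiLp.norm_sq_eq_of_L2, Fin.sum_univ_add, headPart, tailPart]

theorem norm_sq_joinParts {m n : ℕ} (ξ : HPow m H) (η : HPow n H) :
    ‖joinParts ξ η‖ ^ 2 = ‖ξ‖ ^ 2 + ‖η‖ ^ 2 := by
  rw [norm_sq_eq_headPart_add_tailPart, headPart_joinParts, tailPart_joinParts]

end Parts

/-! ### Amplified maps and the affiliated norms that they induce -/

section BlockOperators

variable {H : Type*} [NormedAddCommGroup H] [InnerProductSpace ℂ H]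

theorem inner_blockOp {m : ℕ} (A : Matrix (Fin m) (Fin m) (H →L[ℂ] H)) (ξ η : HPow m H) :
    inner ℂ η (blockOp A ξ) = ∑ i, ∑ j, inner ℂ (η i) (A i j (ξ j)) := by
  simp [PiLp.inner_apply, blockOp_apply, inner_sum]

variable {X : Type*} [AddCommGroup X] [Module ℂ X]

/-- The amplification of a linear map into `B(H)`, as a linear map on matrices. -/
def ampMap (Φ : X →ₗ[ℂ] (H →L[ℂ] H)) (m : ℕ) :
    Matrix (Fin m) (Fin m) X →ₗ[ℂ] (HPow m H →L[ℂ] HPow m H) where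
  toFun x := blockOp (x.map Φ)
  map_add' x y := by
    ext ξ i
    simp [blockOp_apply, Finset.sum_add_distrib]
  map_smul' c x := by
    ext ξ i
    simp [blockOp_apply, Finset.smul_sum]

theorem numRadiusFun_eq (Φ : X →ₗ[ℂ] (H →L[ℂ] H)) {m : ℕ} (x : Matrix (Fin m) (Fin m) X) :
    numRadiusFun Φ m x = numRadius (ampMap Φ m x) := rfl

theorem opNormFun_eq (Φ : X →ₗ[ℂ] (H →L[ℂ] H)) {m : ℕ} (x : Matrix (Fin m) (Fin m) X) :
    opNormFun Φ m x = ‖ampMap Φ m x‖ := rfl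

theorem ampMap_apply (Φ : X →ₗ[ℂ] (H →L[ℂ] H)) {m : ℕ} (x : Matrix (Fin m) (Fin m) X)
    (ξ : HPow m H) (i : Fin m) : ampMap Φ m x ξ i = ∑ j, Φ (x i j) (ξ j) :=
  blockOp_apply _ ξ i

theorem inner_ampMap (Φ : X →ₗ[ℂ] (H →L[ℂ] H)) {m : ℕ} (x : Matrix (Fin m) (Fin m) X)
    (ξ η : HPow m H) :
    inner ℂ η (ampMap Φ m x ξ) = ∑ i, ∑ j, inner ℂ (η i) (Φ (x i j) (ξ j)) :=
  inner_blockOp _ ξ η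

theorem ampMap_sandwich (Φ : X →ₗ[ℂ] (H →L[ℂ] H)) {m r : ℕ} (a : Matrix (Fin m) (Fin r) ℂ)
    (x : Matrix (Fin r) (Fin r) X) (b : Matrix (Fin r) (Fin m) ℂ) (ξ : HPow m H) :
    ampMap Φ m (sandwich a x b) ξ = amp a (ampMap Φ r x (amp b ξ)) := by
  ext i
  simp only [ampMap_apply, amp_apply, sandwich_apply, map_sum, map_smul, sum_apply, smul_apply,
    Finset.smul_sum, smul_smul]
  rw [Finset.sum_comm]
  refine Finset.sum_congr rfl fun s _ => ?_
  exact Finset.sum_comm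

theorem inner_ampMap_diagBlock (Φ : X →ₗ[ℂ] (H →L[ℂ] H)) {m n : ℕ}
    (x : Matrix (Fin m) (Fin m) X) (y : Matrix (Fin n) (Fin n) X) (ξ η : HPow (m + n) H) :
    inner ℂ η (ampMap Φ (m + n) (diagBlock x y) ξ) =
      inner ℂ (headPart η) (ampMap Φ m x (headPart ξ)) +
        inner ℂ (tailPart η) (ampMap Φ n y (tailPart ξ)) := by
  simp [inner_ampMap, Fin.sum_univ_add, headPart, tailPart, -Fin.natAdd_eq_addNat]

theorem inner_ampMap_cornerBlock (Φ : X →ₗ[ℂ] (H →L[ℂ] H)) {m : ℕ}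
    (x : Matrix (Fin m) (Fin m) X) (ξ η : HPow (m + m) H) :
    inner ℂ η (ampMap Φ (m + m) (cornerBlock x) ξ) =
      inner ℂ (headPart η) (ampMap Φ m x (tailPart ξ)) := by
  simp [inner_ampMap, Fin.sum_univ_add, headPart, tailPart, -Fin.natAdd_eq_addNat]

theorem norm_inner_map_le_half_mul {K : Type*} [NormedAddCommGroup K] [InnerProductSpace ℂ K]
    (T : H →L[ℂ] K) (ξ : H) (η : K) :
    ‖inner ℂ η (T ξ)‖ ≤ 1 / 2 * ‖T‖ * (‖η‖ ^ 2 + ‖ξ‖ ^ 2) :=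
  calc ‖inner ℂ η (T ξ)‖ ≤ ‖η‖ * ‖T ξ‖ := norm_inner_le_norm _ _
    _ ≤ ‖η‖ * (‖T‖ * ‖ξ‖) := by gcongr; exact T.le_opNorm ξ
    _ = 1 / 2 * ‖T‖ * (2 * ‖η‖ * ‖ξ‖) := by ring
    _ ≤ 1 / 2 * ‖T‖ * (‖η‖ ^ 2 + ‖ξ‖ ^ 2) := by gcongr; exact two_mul_le_add_sq _ _

/-- The quadratic form of the corner block is `⟨ξ₁, T ξ₂⟩` with `ξ₁`, `ξ₂` independent and `‖ξ‖² =
‖ξ₁‖² + ‖ξ₂‖²`. The arithmetic-geometric mean inequality bounds it by `½ ‖T‖`, and balanced vectors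
show that this is sharp. -/
theorem numRadiusFun_cornerBlock (Φ : X →ₗ[ℂ] (H →L[ℂ] H)) {m : ℕ}
    (x : Matrix (Fin m) (Fin m) X) :
    numRadiusFun Φ (m + m) (cornerBlock x) = 1 / 2 * opNormFun Φ m x := by
  rw [numRadiusFun_eq, opNormFun_eq]
  apply le_antisymm
  · refine numRadius_le (by positivity) fun ξ => ?_
    rw [inner_ampMap_cornerBlock, norm_sq_eq_headPart_add_tailPart]
    exact norm_inner_map_le_half_mul _ _ _
  · have h := opNorm_le_two_mul (T := ampMap Φ m x)
      (numRadius_nonneg (ampMap Φ (m + m) (cornerBlock x))) fun ξ η => by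
        have h := norm_inner_le_numRadius (ampMap Φ (m + m) (cornerBlock x)) (joinParts η ξ)
        rwa [inner_ampMap_cornerBlock, norm_sq_joinParts, headPart_joinParts,
          tailPart_joinParts] at h
    linarith

theorem numRadiusFun_diagBlock (Φ : X →ₗ[ℂ] (H →L[ℂ] H)) {m n : ℕ}
    (x : Matrix (Fin m) (Fin m) X) (y : Matrix (Fin n) (Fin n) X) :
    numRadiusFun Φ (m + n) (diagBlock x y) = max (numRadiusFun Φ m x) (numRadiusFun Φ n y) := by
  simp only [numRadiusFun_eq]
  apply le_antisymm
  · refine numRadius_le (le_max_of_le_left (numRadius_nonneg _)) fun ξ => ?_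
    rw [inner_ampMap_diagBlock, norm_sq_eq_headPart_add_tailPart, mul_add]
    refine (norm_add_le _ _).trans (add_le_add ?_ ?_)
    · refine (norm_inner_le_numRadius _ _).trans ?_
      gcongr
      exact le_max_left _ _
    · refine (norm_inner_le_numRadius _ _).trans ?_
      gcongr
      exact le_max_right _ _
  · refine max_le (numRadius_le (numRadius_nonneg _) fun ξ => ?_)
      (numRadius_le (numRadius_nonneg _) fun ξ => ?_)
    · have h := norm_inner_le_numRadius (ampMap Φ (m + n) (diagBlock x y))
        (joinParts ξ (0 : HPow n H))
      simpa [inner_ampMap_diagBlock, norm_sq_joinParts] using h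
    · have h := norm_inner_le_numRadius (ampMap Φ (m + n) (diagBlock x y))
        (joinParts (0 : HPow m H) ξ)
      simpa [inner_ampMap_diagBlock, norm_sq_joinParts] using h

theorem numRadiusFun_conj_le (Φ : X →ₗ[ℂ] (H →L[ℂ] H)) {m n : ℕ} (α : Matrix (Fin n) (Fin m) ℂ)
    (x : Matrix (Fin m) (Fin m) X) :
    numRadiusFun Φ n (sandwich α x α.conjTranspose) ≤ ‖α‖ ^ 2 * numRadiusFun Φ m x := by
  simp only [numRadiusFun_eq]
  have h0 := numRadius_nonneg (ampMap Φ m x)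
  refine numRadius_le (by positivity) fun ξ => ?_
  rw [ampMap_sandwich, inner_amp_right]
  refine (norm_inner_le_numRadius _ _).trans ?_
  have h := norm_amp_le α.conjTranspose ξ
  rw [Matrix.l2_opNorm_conjTranspose] at h
  calc numRadius (ampMap Φ m x) * ‖amp α.conjTranspose ξ‖ ^ 2
      ≤ numRadius (ampMap Φ m x) * (‖α‖ * ‖ξ‖) ^ 2 := by gcongr
    _ = ‖α‖ ^ 2 * numRadius (ampMap Φ m x) * ‖ξ‖ ^ 2 := by ring

/-- Complete isometry matters only for definiteness and the corner identity; the remaining axioms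
hold for the numerical radii of any linear map into `B(H)`. -/
theorem isAffiliated_numRadiusFun {O : MatFun X} (hO : IsOperatorSpace O)
    {Φ : X →ₗ[ℂ] (H →L[ℂ] H)} (hΦ : IsCompleteIsometry O Φ) :
    IsAffiliated O (numRadiusFun Φ) where
  isNumericalRadius :=
    { isNorm :=
        { add_le := fun m x y => by
            rw [numRadiusFun_eq, map_add]; exact numRadius_add_le _ _
          smul_eq := fun m c x => by
            rw [numRadiusFun_eq, map_smul]; exact numRadius_smul _ _
          definite := fun m x hx => by
            refine hO.isNorm.definite m x ?_
            have h := opNorm_le_two_mul_numRadius (ampMap Φ m x)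
            rw [← numRadiusFun_eq, hx, mul_zero, ← opNormFun_eq, hΦ] at h
            refine le_antisymm h ?_
            rw [← hΦ]
            exact norm_nonneg (ampMap Φ m x) }
      diag_eq := fun _ _ => numRadiusFun_diagBlock Φ
      conj_le := fun _ _ => numRadiusFun_conj_le Φ }
  corner_eq := fun m x => by rw [numRadiusFun_cornerBlock, hΦ]

theorem half_le_numRadiusFun {O : MatFun X} {Φ : X →ₗ[ℂ] (H →L[ℂ] H)}
    (hΦ : IsCompleteIsometry O Φ) {m : ℕ} (x : Matrix (Fin m) (Fin m) X) :
    1 / 2 * O m x ≤ numRadiusFun Φ m x := by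
  have h := opNorm_le_two_mul_numRadius (ampMap Φ m x)
  rw [← opNormFun_eq, hΦ, ← numRadiusFun_eq] at h
  linarith

end BlockOperators

/-! ### Algebra of the products `α x β` -/

section Sandwich

variable {X : Type*} [AddCommGroup X] [Module ℂ X]

@[simp] theorem sandwich_zero_left {k l p q : ℕ} (x : Matrix (Fin l) (Fin p) X)
    (β : Matrix (Fin p) (Fin q) ℂ) : sandwich (0 : Matrix (Fin k) (Fin l) ℂ) x β = 0 := by
  ext i j; simp [sandwich_apply]

theorem sandwich_smul_left {k l p q : ℕ} (c : ℂ) (α : Matrix (Fin k) (Fin l) ℂ)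
    (x : Matrix (Fin l) (Fin p) X) (β : Matrix (Fin p) (Fin q) ℂ) :
    sandwich (c • α) x β = c • sandwich α x β := by
  ext i j; simp [sandwich_apply, Finset.smul_sum, smul_smul, mul_assoc]

theorem sandwich_smul_middle {k l p q : ℕ} (c : ℂ) (α : Matrix (Fin k) (Fin l) ℂ)
    (x : Matrix (Fin l) (Fin p) X) (β : Matrix (Fin p) (Fin q) ℂ) :
    sandwich α (c • x) β = c • sandwich α x β := by
  ext i j; simp [sandwich_apply, Finset.smul_sum, smul_smul, mul_comm]

theorem sandwich_smul_right {k l p q : ℕ} (c : ℂ) (α : Matrix (Fin k) (Fin l) ℂ)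
    (x : Matrix (Fin l) (Fin p) X) (β : Matrix (Fin p) (Fin q) ℂ) :
    sandwich α x (c • β) = c • sandwich α x β := by
  ext i j; simp [sandwich_apply, Finset.smul_sum, smul_smul, mul_left_comm]

@[simp] theorem sandwich_zero_middle {k l p q : ℕ} (α : Matrix (Fin k) (Fin l) ℂ)
    (β : Matrix (Fin p) (Fin q) ℂ) : sandwich α (0 : Matrix (Fin l) (Fin p) X) β = 0 := by
  ext i j; simp [sandwich_apply]

@[simp] theorem sandwich_one_one {l p : ℕ} (x : Matrix (Fin l) (Fin p) X) :
    sandwich (1 : Matrix (Fin l) (Fin l) ℂ) x (1 : Matrix (Fin p) (Fin p) ℂ) = x := by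
  ext i j
  simp [sandwich_apply, Matrix.one_apply]

theorem sandwich_submatrix {k l p q k' q' : ℕ} (α : Matrix (Fin k) (Fin l) ℂ)
    (x : Matrix (Fin l) (Fin p) X) (β : Matrix (Fin p) (Fin q) ℂ) (f : Fin k' → Fin k)
    (g : Fin q' → Fin q) :
    (sandwich α x β).submatrix f g = sandwich (α.submatrix f id) x (β.submatrix id g) := rfl

end Sandwich

/-! ### Bounds for the maximal numerical radius norm -/

section Wmax

variable {X : Type*} [AddCommGroup X] [Module ℂ X] {O : MatFun X}

theorem IsNormFamily.zero (hN : IsNormFamily O) (m : ℕ) : O m 0 = 0 := by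
  simpa using hN.smul_eq m 0 0

theorem IsNormFamily.nonneg (hN : IsNormFamily O) {m : ℕ} (x : Matrix (Fin m) (Fin m) X) :
    0 ≤ O m x := by
  have h1 := hN.add_le m x ((-1 : ℂ) • x)
  have h2 := hN.smul_eq m (-1) x
  rw [neg_one_smul, add_neg_cancel, hN.zero, ← neg_one_smul ℂ x, h2, norm_neg, norm_one,
    one_mul] at h1
  linarith

theorem IsNormFamily.pos (hN : IsNormFamily O) {m : ℕ} {x : Matrix (Fin m) (Fin m) X}
    (hx : x ≠ 0) : 0 < O m x :=
  (hN.nonneg x).lt_of_ne fun h => hx (hN.definite m x h.symm)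

theorem Wmax_nonneg (m : ℕ) (x : Matrix (Fin m) (Fin m) X) : 0 ≤ Wmax O m x := by
  apply Real.sInf_nonneg
  rintro s ⟨r, a, y, b, -, -, rfl⟩
  positivity

theorem Wmax_le_of_eq_one {m r : ℕ} (a : Matrix (Fin m) (Fin r) ℂ)
    (y : Matrix (Fin r) (Fin r) X) (b : Matrix (Fin r) (Fin m) ℂ) (hy : O r y = 1) :
    Wmax O m (sandwich a y b) ≤ 1 / 2 * ‖a * a.conjTranspose + b.conjTranspose * b‖ := by
  refine csInf_le ⟨0, ?_⟩ ⟨r, a, y, b, rfl, hy, rfl⟩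
  rintro s ⟨r, a, y, b, -, -, rfl⟩
  positivity

theorem IsNormFamily.exists_eq_smul (hN : IsNormFamily O) {m : ℕ}
    {x : Matrix (Fin m) (Fin m) X} (hx : x ≠ 0) :
    ∃ y : Matrix (Fin m) (Fin m) X, O m y = 1 ∧ x = (O m x : ℂ) • y := by
  have hpos := hN.pos hx
  have hne : (O m x : ℂ) ≠ 0 := Complex.ofReal_ne_zero.2 hpos.ne'
  refine ⟨(O m x : ℂ)⁻¹ • x, ?_, ?_⟩
  · rw [hN.smul_eq, norm_inv, Complex.norm_real, Real.norm_of_nonneg hpos.le,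
      inv_mul_cancel₀ hpos.ne']
  · rw [smul_smul, mul_inv_cancel₀ hne, one_smul]

theorem Wmax_zero (O : MatFun X) (m : ℕ) : Wmax O m 0 = 0 := by
  refine le_antisymm ?_ (Wmax_nonneg m 0)
  by_cases h : ∃ (r : ℕ) (y : Matrix (Fin r) (Fin r) X), O r y = 1
  · obtain ⟨r, y, hy⟩ := h
    simpa using Wmax_le_of_eq_one (0 : Matrix (Fin m) (Fin r) ℂ) y 0 hy
  · push Not at h
    refine (Real.sInf_nonpos ?_)
    rintro s ⟨r, a, y, b, -, hy, -⟩
    exact absurd hy (h r y)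

theorem sqrt_smul_mul_sqrt_smul {k l p : ℕ} {c : ℝ} (hc : 0 ≤ c) (a : Matrix (Fin k) (Fin l) ℂ)
    (b : Matrix (Fin l) (Fin p) ℂ) :
    ((√c : ℝ) : ℂ) • a * ((√c : ℝ) : ℂ) • b = (c : ℂ) • (a * b) := by
  rw [Matrix.smul_mul, Matrix.mul_smul, smul_smul, ← Complex.ofReal_mul, Real.mul_self_sqrt hc]

theorem sandwich_sqrt_smul {k l p q : ℕ} {c : ℝ} (hc : 0 ≤ c) (a : Matrix (Fin k) (Fin l) ℂ)
    (x : Matrix (Fin l) (Fin p) X) (b : Matrix (Fin p) (Fin q) ℂ) :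
    sandwich (((√c : ℝ) : ℂ) • a) x (((√c : ℝ) : ℂ) • b) = (c : ℂ) • sandwich a x b := by
  rw [sandwich_smul_left, sandwich_smul_right, smul_smul, ← Complex.ofReal_mul,
    Real.mul_self_sqrt hc]

theorem conjTranspose_ofReal_smul {k l : ℕ} (c : ℝ) (a : Matrix (Fin k) (Fin l) ℂ) :
    ((c : ℂ) • a).conjTranspose = (c : ℂ) • a.conjTranspose := by
  rw [Matrix.conjTranspose_smul, RCLike.star_def, Complex.conj_ofReal]

theorem sqrt_smul_mul_conjTranspose_add {m r : ℕ} {c : ℝ} (hc : 0 ≤ c)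
    (a : Matrix (Fin m) (Fin r) ℂ) (b : Matrix (Fin r) (Fin m) ℂ) :
    ((√c : ℝ) : ℂ) • a * (((√c : ℝ) : ℂ) • a).conjTranspose +
      (((√c : ℝ) : ℂ) • b).conjTranspose * ((√c : ℝ) : ℂ) • b =
      (c : ℂ) • (a * a.conjTranspose + b.conjTranspose * b) := by
  rw [conjTranspose_ofReal_smul, conjTranspose_ofReal_smul, sqrt_smul_mul_sqrt_smul hc,
    sqrt_smul_mul_sqrt_smul hc, smul_add]

/-- The normalization `O y = 1` is removed by moving the factor `√(O y)` into each of `a` and `b`,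
which scales `aa* + b*b` by exactly `O y`. -/
theorem Wmax_sandwich_le (hN : IsNormFamily O) {m r : ℕ} (a : Matrix (Fin m) (Fin r) ℂ)
    (y : Matrix (Fin r) (Fin r) X) (b : Matrix (Fin r) (Fin m) ℂ) :
    Wmax O m (sandwich a y b) ≤
      1 / 2 * ‖a * a.conjTranspose + b.conjTranspose * b‖ * O r y := by
  by_cases hy : y = 0
  · rw [hy, sandwich_zero_middle, Wmax_zero, hN.zero, mul_zero]
  obtain ⟨z, hz, hyz⟩ := hN.exists_eq_smul hy
  have h0 := hN.nonneg y
  have h := Wmax_le_of_eq_one (((√(O r y) : ℝ) : ℂ) • a) z (((√(O r y) : ℝ) : ℂ) • b) hz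
  rw [sandwich_sqrt_smul h0, ← sandwich_smul_middle, ← hyz, sqrt_smul_mul_conjTranspose_add h0,
    norm_smul, Complex.norm_real, Real.norm_of_nonneg h0] at h
  linarith

/-- The infimum of an empty set of reals is `0`, so `x = 0`, where factorizations may be missing,
needs its own hypothesis. For `x ≠ 0` normalizing `x` gives a factorization. -/
theorem le_Wmax (hN : IsNormFamily O) {m : ℕ} {x : Matrix (Fin m) (Fin m) X} {L : ℝ}
    (h0 : x = 0 → L ≤ 0)
    (h : ∀ (r : ℕ) (a : Matrix (Fin m) (Fin r) ℂ) (y : Matrix (Fin r) (Fin r) X)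
      (b : Matrix (Fin r) (Fin m) ℂ), x = sandwich a y b → O r y = 1 →
        L ≤ 1 / 2 * ‖a * a.conjTranspose + b.conjTranspose * b‖) : L ≤ Wmax O m x := by
  by_cases hx : x = 0
  · exact (h0 hx).trans (Wmax_nonneg m x)
  refine le_csInf ?_ ?_
  · obtain ⟨y, hy, hxy⟩ := hN.exists_eq_smul hx
    refine ⟨_, m, (O m x : ℂ) • 1, y, 1, ?_, hy, rfl⟩
    rw [sandwich_smul_left, sandwich_one_one, ← hxy]
  · rintro s ⟨r, a, y, b, hx, hy, rfl⟩
    exact h r a y b hx hy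

/-- Selecting rows is left multiplication by a matrix `P` with `P P* = 1`, hence of norm at most
one. -/
theorem norm_submatrix_left_le {k k' l : ℕ} (a : Matrix (Fin k) (Fin l) ℂ) {f : Fin k' → Fin k}
    (hf : Function.Injective f) : ‖a.submatrix f id‖ ≤ ‖a‖ := by
  have hP : ‖(1 : Matrix (Fin k) (Fin k) ℂ).submatrix f id‖ ≤ 1 := by
    have h := Matrix.l2_opNorm_conjTranspose_mul_self
      ((1 : Matrix (Fin k) (Fin k) ℂ).submatrix f id).conjTranspose
    have e : ((1 : Matrix (Fin k) (Fin k) ℂ).submatrix f id).conjTranspose.conjTranspose *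
        ((1 : Matrix (Fin k) (Fin k) ℂ).submatrix f id).conjTranspose = 1 := by
      rw [Matrix.conjTranspose_conjTranspose, Matrix.conjTranspose_submatrix,
        Matrix.conjTranspose_one, ← Matrix.submatrix_mul _ _ f id f Function.bijective_id,
        Matrix.one_mul, Matrix.submatrix_one f hf]
    rw [e, Matrix.l2_opNorm_conjTranspose] at h
    have h1 : ‖(1 : Matrix (Fin k') (Fin k') ℂ)‖ ≤ 1 := by
      rcases isEmpty_or_nonempty (Fin k') with hk | hk
      · rw [Subsingleton.elim (1 : Matrix (Fin k') (Fin k') ℂ) 0, norm_zero]; exact zero_le_one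
      · exact CStarRing.norm_one.le
    nlinarith [norm_nonneg ((1 : Matrix (Fin k) (Fin k) ℂ).submatrix f id)]
  have e : a.submatrix f id = (1 : Matrix (Fin k) (Fin k) ℂ).submatrix f id * a := by
    conv_lhs => rw [← Matrix.one_mul a, Matrix.submatrix_mul _ _ f id id Function.bijective_id,
      Matrix.submatrix_id_id]
  rw [e]
  refine (Matrix.l2_opNorm_mul _ _).trans ?_
  exact mul_le_of_le_one_left (norm_nonneg a) hP

theorem norm_submatrix_right_le {k l l' : ℕ} (a : Matrix (Fin k) (Fin l) ℂ) {f : Fin l' → Fin l}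
    (hf : Function.Injective f) : ‖a.submatrix id f‖ ≤ ‖a‖ := by
  rw [← Matrix.l2_opNorm_conjTranspose, Matrix.conjTranspose_submatrix,
    ← Matrix.l2_opNorm_conjTranspose a]
  exact norm_submatrix_left_le _ hf

theorem norm_mul_norm_le {m r : ℕ} (a : Matrix (Fin m) (Fin r) ℂ) (b : Matrix (Fin r) (Fin m) ℂ) :
    ‖a‖ * ‖b‖ ≤ ‖a * a.conjTranspose + b.conjTranspose * b‖ := by
  have ha : 0 ≤ a * a.conjTranspose := (Matrix.posSemidef_self_mul_conjTranspose a).nonneg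
  have hb : 0 ≤ b.conjTranspose * b := (Matrix.posSemidef_conjTranspose_mul_self b).nonneg
  have h1 := CStarAlgebra.norm_le_norm_of_nonneg_of_le ha (le_add_of_nonneg_right hb)
  have h2 := CStarAlgebra.norm_le_norm_of_nonneg_of_le hb (le_add_of_nonneg_left ha)
  rw [Matrix.l2_opNorm_conjTranspose_mul_self] at h2
  have h3 := Matrix.l2_opNorm_conjTranspose_mul_self a.conjTranspose
  rw [Matrix.conjTranspose_conjTranspose, Matrix.l2_opNorm_conjTranspose] at h3
  rw [h3] at h1
  nlinarith [sq_nonneg (‖a‖ - ‖b‖)]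

/-- The upper rows of `a` and the last columns of `b` factor `x` itself, so `O x ≤ ‖a‖ ‖b‖ ≤ ‖aa* +
b*b‖`. This later upgrades the maximal representation from contractive to isometric. -/
theorem half_le_Wmax_cornerBlock (hO : IsOperatorSpace O) {m : ℕ}
    (x : Matrix (Fin m) (Fin m) X) : 1 / 2 * O m x ≤ Wmax O (m + m) (cornerBlock x) := by
  refine le_Wmax hO.isNorm (fun h => ?_) fun r a y b h hy => ?_
  · have hx : x = 0 := by
      ext i j
      rw [← cornerBlock_castAdd_natAdd x i j, h]; rfl
    rw [hx, hO.isNorm.zero, mul_zero]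
  · have hx : x = sandwich (a.submatrix (Fin.castAdd m) id) y (b.submatrix id (Fin.natAdd m)) := by
      rw [← sandwich_submatrix, ← h]
      ext i j
      exact (cornerBlock_castAdd_natAdd x i j).symm
    have h1 := hO.sandwich_le _ _ (a.submatrix (Fin.castAdd m) id) y
      (b.submatrix id (Fin.natAdd m))
    rw [← hx, hy, mul_one] at h1
    have h2 := norm_submatrix_left_le a (Fin.castAdd_injective m m)
    have h3 := norm_submatrix_right_le b (Fin.natAdd_injective m m)
    have h4 := norm_mul_norm_le a b
    have h5 := mul_le_mul h2 h3 (norm_nonneg _) (norm_nonneg _)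
    linarith

theorem norm_add_of_nonneg_fin_one {a b : Matrix (Fin 1) (Fin 1) ℂ} (ha : 0 ≤ a) (hb : 0 ≤ b) :
    ‖a + b‖ = ‖a‖ + ‖b‖ := by
  have key (c : Matrix (Fin 1) (Fin 1) ℂ) : c = algebraMap ℂ _ (c 0 0) := by
    ext i j
    fin_cases i; fin_cases j
    simp [Matrix.algebraMap_matrix_apply]
  have hnn {c : Matrix (Fin 1) (Fin 1) ℂ} (hc : 0 ≤ c) : 0 ≤ c 0 0 :=
    (Matrix.nonneg_iff_posSemidef.1 hc).diag_nonneg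
  rw [key a, key b, ← map_add, norm_algebraMap', norm_algebraMap', norm_algebraMap']
  have h1 := Complex.eq_coe_norm_of_nonneg (hnn ha)
  have h2 := Complex.eq_coe_norm_of_nonneg (hnn hb)
  rw [h1, h2, ← Complex.ofReal_add, Complex.norm_real, Complex.norm_real, Complex.norm_real]
  simp [abs_of_nonneg, add_nonneg]

/-- For `1 × 1` matrices `‖aa* + b*b‖ = ‖a‖² + ‖b‖² ≥ 2 ‖a‖ ‖b‖`, twice the bound valid in general.
This is the gap between `Wmin` and `Wmax` used for uncountability. -/
theorem le_Wmax_fin_one (hO : IsOperatorSpace O) (x : Matrix (Fin 1) (Fin 1) X) :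
    O 1 x ≤ Wmax O 1 x := by
  refine le_Wmax hO.isNorm (fun h => by rw [h, hO.isNorm.zero]) fun r a y b h hy => ?_
  have h1 := hO.sandwich_le _ _ a y b
  rw [← h, hy, mul_one] at h1
  rw [norm_add_of_nonneg_fin_one (Matrix.posSemidef_self_mul_conjTranspose a).nonneg
    (Matrix.posSemidef_conjTranspose_mul_self b).nonneg, Matrix.l2_opNorm_conjTranspose_mul_self]
  have h3 := Matrix.l2_opNorm_conjTranspose_mul_self a.conjTranspose
  rw [Matrix.conjTranspose_conjTranspose, Matrix.l2_opNorm_conjTranspose] at h3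
  rw [h3]
  nlinarith [sq_nonneg (‖a‖ - ‖b‖)]

variable {H : Type*} [NormedAddCommGroup H] [InnerProductSpace ℂ H]

/-- `Φ` is completely contractive on the matricially normed space `(X, O)`. -/
def IsCompleteContraction (O : MatFun X) (Φ : X →ₗ[ℂ] (H →L[ℂ] H)) : Prop :=
  ∀ (m : ℕ) (x : Matrix (Fin m) (Fin m) X), opNormFun Φ m x ≤ O m x

theorem IsCompleteIsometry.isCompleteContraction {Φ : X →ₗ[ℂ] (H →L[ℂ] H)}
    (hΦ : IsCompleteIsometry O Φ) : IsCompleteContraction O Φ := fun m x => (hΦ m x).le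

/-- For `x = a y b` the adjoint of `a` moves to the left, and `½ (‖a* ξ‖² + ‖b ξ‖²)` is half the
quadratic form of `aa* + b*b` at `ξ`. -/
theorem numRadiusFun_le_Wmax (hN : IsNormFamily O) {Φ : X →ₗ[ℂ] (H →L[ℂ] H)}
    (hΦ : IsCompleteContraction O Φ) {m : ℕ} (x : Matrix (Fin m) (Fin m) X) :
    numRadiusFun Φ m x ≤ Wmax O m x := by
  rw [numRadiusFun_eq]
  refine le_Wmax hN (fun h => ?_) fun r a y b h hy => ?_
  · rw [h, map_zero]
    exact (numRadius_le_opNorm _).trans_eq norm_zero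
  refine numRadius_le (by positivity) fun ξ => ?_
  have hsa : IsSelfAdjoint (a * a.conjTranspose + b.conjTranspose * b) :=
    (Matrix.isHermitian_mul_conjTranspose_self a).add
      (Matrix.isHermitian_conjTranspose_mul_self b)
  have h1 := re_inner_amp_le hsa ξ
  have h2 := inner_amp_conjTranspose_mul_self a.conjTranspose ξ
  rw [Matrix.conjTranspose_conjTranspose] at h2
  rw [amp_add, inner_add_right, h2, inner_amp_conjTranspose_mul_self, ← Complex.ofReal_add,
    Complex.ofReal_re] at h1
  have h3 := hΦ r y
  rw [opNormFun_eq, hy] at h3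
  rw [h, ampMap_sandwich, inner_amp_right]
  calc ‖inner ℂ (amp a.conjTranspose ξ) (ampMap Φ r y (amp b ξ))‖
      ≤ 1 / 2 * ‖ampMap Φ r y‖ * (‖amp a.conjTranspose ξ‖ ^ 2 + ‖amp b ξ‖ ^ 2) :=
        norm_inner_map_le_half_mul _ _ _
    _ ≤ 1 / 2 * 1 * (‖a * a.conjTranspose + b.conjTranspose * b‖ * ‖ξ‖ ^ 2) := by gcongr
    _ = _ := by ring

end Wmax

/-! ### Interchanging the two tensor factors -/

section SwapFactors

variable {H : Type*}

/-- The identification of `(H ^ n) ^ m` with `(H ^ m) ^ n`. -/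
def swapFactors {m n : ℕ} (ζ : HPow m (HPow n H)) : HPow n (HPow m H) :=
  WithLp.toLp 2 fun k => WithLp.toLp 2 fun i => ζ i k

@[simp] theorem swapFactors_apply {m n : ℕ} (ζ : HPow m (HPow n H)) (k : Fin n) (i : Fin m) :
    swapFactors ζ k i = ζ i k := rfl

@[simp] theorem swapFactors_swapFactors {m n : ℕ} (ζ : HPow m (HPow n H)) :
    swapFactors (swapFactors ζ) = ζ := rfl

variable [NormedAddCommGroup H]

theorem norm_sq_swapFactors {m n : ℕ} (ζ : HPow m (HPow n H)) :
    ‖swapFactors ζ‖ ^ 2 = ‖ζ‖ ^ 2 := by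
  simp only [PiLp.norm_sq_eq_of_L2, swapFactors_apply]
  exact Finset.sum_comm

theorem norm_swapFactors {m n : ℕ} (ζ : HPow m (HPow n H)) : ‖swapFactors ζ‖ = ‖ζ‖ :=
  (sq_eq_sq₀ (norm_nonneg _) (norm_nonneg _)).1 (norm_sq_swapFactors ζ)

end SwapFactors

/-! ### Tensoring with a fixed scalar matrix -/

section Tensor

variable {H : Type*} [NormedAddCommGroup H] [InnerProductSpace ℂ H]

theorem tensorRight_apply {n : ℕ} (a : Matrix (Fin n) (Fin n) ℂ) (T : H →L[ℂ] H) (ζ : HPow n H)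
    (k : Fin n) : tensorRight a T ζ k = T (amp a ζ k) := by
  simp [tensorRight, blockOp_apply]

theorem tensorRight_sub {n : ℕ} (a b : Matrix (Fin n) (Fin n) ℂ) (T : H →L[ℂ] H) :
    tensorRight (a - b) T = tensorRight a T - tensorRight b T := by
  ext ζ k
  simp [tensorRight_apply, sub_smul]

theorem norm_tensorRight_le {n : ℕ} (a : Matrix (Fin n) (Fin n) ℂ) (T : H →L[ℂ] H) :
    ‖tensorRight a T‖ ≤ ‖a‖ * ‖T‖ := by
  refine ContinuousLinearMap.opNorm_le_bound _ (by positivity) fun ζ => ?_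
  have h : ‖tensorRight a T ζ‖ ≤ ‖T‖ * ‖amp a ζ‖ := by
    refine (pow_le_pow_iff_left₀ (norm_nonneg _) (by positivity) two_ne_zero).1 ?_
    rw [mul_pow, PiLp.norm_sq_eq_of_L2, PiLp.norm_sq_eq_of_L2, Finset.mul_sum]
    refine Finset.sum_le_sum fun k _ => ?_
    rw [tensorRight_apply, ← mul_pow]
    gcongr
    exact T.le_opNorm _
  calc ‖tensorRight a T ζ‖ ≤ ‖T‖ * ‖amp a ζ‖ := h
    _ ≤ ‖T‖ * (‖a‖ * ‖ζ‖) := by gcongr; exact norm_amp_le a ζ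
    _ = ‖a‖ * ‖T‖ * ‖ζ‖ := by ring

theorem continuous_tensorRight {n : ℕ} (T : H →L[ℂ] H) :
    Continuous fun a : Matrix (Fin n) (Fin n) ℂ => tensorRight a T := by
  have h : LipschitzWith ‖T‖₊ fun a : Matrix (Fin n) (Fin n) ℂ => tensorRight a T := by
    refine LipschitzWith.of_dist_le_mul fun a b => ?_
    rw [dist_eq_norm, dist_eq_norm, ← tensorRight_sub, coe_nnnorm, mul_comm]
    exact norm_tensorRight_le _ _
  exact h.continuous

/-- The elementary tensor `ξ ⊗ v` in `H ⊗ ℂⁿ = Hⁿ`. -/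
def pureTensor {n : ℕ} (v : Fin n → ℂ) (ξ : H) : HPow n H := WithLp.toLp 2 fun k => v k • ξ

@[simp] theorem pureTensor_apply {n : ℕ} (v : Fin n → ℂ) (ξ : H) (k : Fin n) :
    pureTensor v ξ k = v k • ξ := rfl

theorem tensorRight_pureTensor {n : ℕ} (a : Matrix (Fin n) (Fin n) ℂ) (T : H →L[ℂ] H)
    (v : Fin n → ℂ) (ξ : H) :
    tensorRight a T (pureTensor v ξ) = pureTensor (a.mulVec v) (T ξ) := by
  ext k
  simp [tensorRight_apply, Matrix.mulVec, dotProduct, Finset.sum_smul, smul_smul]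

theorem inner_pureTensor {n : ℕ} (u v : Fin n → ℂ) (ξ η : H) :
    inner ℂ (pureTensor u ξ) (pureTensor v η) = (star u ⬝ᵥ v) * inner ℂ ξ η := by
  simp only [PiLp.inner_apply, pureTensor_apply, inner_smul_left, inner_smul_right, dotProduct,
    Finset.sum_mul, Pi.star_apply, RCLike.star_def]
  exact Finset.sum_congr rfl fun k _ => by ring

theorem norm_sq_pureTensor {n : ℕ} (v : Fin n → ℂ) (ξ : H) :
    ‖pureTensor v ξ‖ ^ 2 = (∑ k, ‖v k‖ ^ 2) * ‖ξ‖ ^ 2 := by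
  simp [PiLp.norm_sq_eq_of_L2, norm_smul, mul_pow, Finset.sum_mul]

/-- On the tensors `ξ ⊗ v` the operator acts as `ξ ⊗ v ↦ T ξ ⊗ a v`, and both `v` and `a v` are unit
vectors. -/
theorem norm_le_norm_tensorRight {n : ℕ} {a : Matrix (Fin n) (Fin n) ℂ} {v : Fin n → ℂ}
    (hv : ∑ k, ‖v k‖ ^ 2 = 1) (hav : ∑ k, ‖a.mulVec v k‖ ^ 2 = 1) (T : H →L[ℂ] H) :
    ‖T‖ ≤ ‖tensorRight a T‖ := by
  refine T.opNorm_le_bound (ContinuousLinearMap.opNorm_nonneg _) fun ξ => ?_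
  have h := (tensorRight a T).le_opNorm (pureTensor v ξ)
  have h1 := norm_sq_pureTensor v ξ
  have h2 := norm_sq_pureTensor (a.mulVec v) (T ξ)
  rw [hv, one_mul, sq_eq_sq₀ (norm_nonneg _) (norm_nonneg _)] at h1
  rw [hav, one_mul, sq_eq_sq₀ (norm_nonneg _) (norm_nonneg _)] at h2
  rwa [tensorRight_pureTensor, h1, h2] at h

/-- On tensors `ξ ⊗ v` the quadratic form of `T ⊗ a` is `⟨v, a v⟩ ⟨ξ, T ξ⟩`. The vector `v` is left
unnormalized so that the sine vector can be inserted directly. -/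
theorem norm_dotProduct_mul_numRadius_le {n : ℕ} (a : Matrix (Fin n) (Fin n) ℂ) (v : Fin n → ℂ)
    (hv : ∑ k, ‖v k‖ ^ 2 ≠ 0) (T : H →L[ℂ] H) :
    ‖star v ⬝ᵥ a.mulVec v‖ / (∑ k, ‖v k‖ ^ 2) * numRadius T ≤ numRadius (tensorRight a T) := by
  have hpos : 0 < ∑ k, ‖v k‖ ^ 2 := (Finset.sum_nonneg fun k _ => by positivity).lt_of_ne' hv
  have key (ξ : H) : ‖star v ⬝ᵥ a.mulVec v‖ * ‖inner ℂ ξ (T ξ)‖ ≤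
      numRadius (tensorRight a T) * (∑ k, ‖v k‖ ^ 2) * ‖ξ‖ ^ 2 := by
    have h := norm_inner_le_numRadius (tensorRight a T) (pureTensor v ξ)
    rwa [tensorRight_pureTensor, inner_pureTensor, norm_mul, norm_sq_pureTensor, ← mul_assoc] at h
  by_cases h0 : ‖star v ⬝ᵥ a.mulVec v‖ = 0
  · rw [h0, zero_div, zero_mul]; exact numRadius_nonneg _
  have hpos' : 0 < ‖star v ⬝ᵥ a.mulVec v‖ := (norm_nonneg _).lt_of_ne' h0
  have hw := numRadius_nonneg (tensorRight a T)
  have h : numRadius T ≤ numRadius (tensorRight a T) * (∑ k, ‖v k‖ ^ 2) /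
      ‖star v ⬝ᵥ a.mulVec v‖ := by
    refine numRadius_le (by positivity) fun ξ => ?_
    rw [div_mul_eq_mul_div, le_div_iff₀ hpos', mul_comm]
    exact key ξ
  rw [le_div_iff₀ hpos'] at h
  rw [div_mul_eq_mul_div, div_le_iff₀ hpos, mul_comm]
  exact h

variable {X : Type*} [AddCommGroup X] [Module ℂ X]

theorem inner_swapFactors {m n : ℕ} (ζ θ : HPow m (HPow n H)) :
    inner ℂ (swapFactors ζ) (swapFactors θ) = inner ℂ ζ θ := by
  simp only [PiLp.inner_apply, swapFactors_apply]
  exact Finset.sum_comm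

/-- Reduces all matrix levels to one operator: amplifying `Φ ⊗ a` is, up to a unitary, tensoring the
amplification of `Φ` with `a`. -/
theorem swapFactors_ampMap_tensorMap {m n : ℕ} (Φ : X →ₗ[ℂ] (H →L[ℂ] H))
    (a : Matrix (Fin n) (Fin n) ℂ) (x : Matrix (Fin m) (Fin m) X) (ζ : HPow m (HPow n H)) :
    swapFactors (ampMap (tensorMap Φ a) m x ζ) =
      tensorRight a (ampMap Φ m x) (swapFactors ζ) := by
  ext k i
  simp [tensorRight_apply, ampMap_apply, tensorMap, Finset.smul_sum]
  exact Finset.sum_comm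

theorem ampMap_tensorMap_swapFactors {m n : ℕ} (Φ : X →ₗ[ℂ] (H →L[ℂ] H))
    (a : Matrix (Fin n) (Fin n) ℂ) (x : Matrix (Fin m) (Fin m) X) (ζ : HPow n (HPow m H)) :
    swapFactors (ampMap (tensorMap Φ a) m x (swapFactors ζ)) =
      tensorRight a (ampMap Φ m x) ζ := by
  rw [swapFactors_ampMap_tensorMap, swapFactors_swapFactors]

theorem opNormFun_tensorMap {m n : ℕ} (Φ : X →ₗ[ℂ] (H →L[ℂ] H))
    (a : Matrix (Fin n) (Fin n) ℂ) (x : Matrix (Fin m) (Fin m) X) :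
    opNormFun (tensorMap Φ a) m x = ‖tensorRight a (ampMap Φ m x)‖ := by
  rw [opNormFun_eq]
  apply le_antisymm
  · refine ContinuousLinearMap.opNorm_le_bound _ (ContinuousLinearMap.opNorm_nonneg _) fun ζ => ?_
    rw [← norm_swapFactors, swapFactors_ampMap_tensorMap, ← norm_swapFactors ζ]
    exact ContinuousLinearMap.le_opNorm _ _
  · refine ContinuousLinearMap.opNorm_le_bound _ (ContinuousLinearMap.opNorm_nonneg _) fun ζ => ?_
    rw [← ampMap_tensorMap_swapFactors, norm_swapFactors, ← norm_swapFactors ζ]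
    exact ContinuousLinearMap.le_opNorm _ _

theorem tensorNorm_eq {m n : ℕ} (Φ : X →ₗ[ℂ] (H →L[ℂ] H))
    (a : Matrix (Fin n) (Fin n) ℂ) (x : Matrix (Fin m) (Fin m) X) :
    tensorNorm Φ a m x = numRadius (tensorRight a (ampMap Φ m x)) := by
  rw [tensorNorm, numRadiusFun_eq]
  apply le_antisymm
  · refine numRadius_le (numRadius_nonneg _) fun ζ => ?_
    rw [← inner_swapFactors, swapFactors_ampMap_tensorMap, ← norm_swapFactors ζ]
    exact norm_inner_le_numRadius _ _
  · refine numRadius_le (numRadius_nonneg _) fun ζ => ?_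
    rw [← ampMap_tensorMap_swapFactors, ← swapFactors_swapFactors ζ, inner_swapFactors,
      norm_swapFactors]
    exact norm_inner_le_numRadius _ _

theorem isCompleteIsometry_tensorMap {O : MatFun X} {Φ : X →ₗ[ℂ] (H →L[ℂ] H)}
    (hΦ : IsCompleteIsometry O Φ) {n : ℕ} {a : Matrix (Fin n) (Fin n) ℂ} (ha : ‖a‖ = 1)
    {v : Fin n → ℂ} (hv : ∑ k, ‖v k‖ ^ 2 = 1) (hav : ∑ k, ‖a.mulVec v k‖ ^ 2 = 1) :
    IsCompleteIsometry O (tensorMap Φ a) := by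
  intro m x
  rw [opNormFun_tensorMap, ← hΦ m x, opNormFun_eq]
  refine le_antisymm ?_ (norm_le_norm_tensorRight hv hav _)
  have h := norm_tensorRight_le a (ampMap Φ m x)
  rwa [ha, one_mul] at h

theorem continuous_tensorNorm {n : ℕ} {a : ℝ → Matrix (Fin n) (Fin n) ℂ} (ha : Continuous a)
    (Φ : X →ₗ[ℂ] (H →L[ℂ] H)) {m : ℕ} (x : Matrix (Fin m) (Fin m) X) :
    Continuous fun t => tensorNorm Φ (a t) m x := by
  simp only [tensorNorm_eq]
  exact continuous_numRadius.comp ((continuous_tensorRight _).comp ha)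

/-- An off-diagonal matrix unit gives the form `⟨ζ i, T (ζ j)⟩` in two distinct coordinates, as for
a corner block. -/
theorem numRadius_tensorRight_le_half {n : ℕ} {a : Matrix (Fin n) (Fin n) ℂ} {i j : Fin n}
    (hij : i ≠ j) (ha : a = Matrix.single i j 1) (T : H →L[ℂ] H) :
    numRadius (tensorRight a T) ≤ 1 / 2 * ‖T‖ := by
  refine numRadius_le (by positivity) fun ζ => ?_
  have h : inner ℂ ζ (tensorRight a T ζ) = inner ℂ (ζ i) (T (ζ j)) := by
    rw [PiLp.inner_apply, Finset.sum_eq_single i]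
    · rw [tensorRight_apply, ha]
      congr 2
      simp [Matrix.single_apply]
    · intro k _ hk
      rw [tensorRight_apply, ha]
      simp [hk.symm]
    · simp
  rw [h]
  refine (norm_inner_map_le_half_mul T _ _).trans ?_
  gcongr
  rw [PiLp.norm_sq_eq_of_L2, ← Finset.sum_pair (f := fun k => ‖ζ k‖ ^ 2) hij]
  exact Finset.sum_le_univ_sum_of_nonneg fun k => by positivity

theorem tensorNorm_single_eq_Wmin {O : MatFun X} {Φ : X →ₗ[ℂ] (H →L[ℂ] H)}
    (hΦ : IsCompleteIsometry O Φ) {n : ℕ} {a : Matrix (Fin n) (Fin n) ℂ} {i j : Fin n}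
    (hij : i ≠ j) (ha : a = Matrix.single i j 1) (hiso : IsCompleteIsometry O (tensorMap Φ a)) :
    tensorNorm Φ a = Wmin O := by
  funext m x
  refine le_antisymm ?_ (half_le_numRadiusFun hiso x)
  rw [tensorNorm_eq, Wmin, ← hΦ m x, opNormFun_eq]
  exact numRadius_tensorRight_le_half hij ha _

end Tensor

/-! ### The two paths of matrices and their endpoints -/

section Paths

theorem norm_eq_one_of_conjTranspose_mul_self_eq_diagonal {n : ℕ}
    {a : Matrix (Fin n) (Fin n) ℂ} {d : Fin n → ℂ} (h : a.conjTranspose * a = Matrix.diagonal d)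
    (hd : ∀ k, ‖d k‖ ≤ 1) {j : Fin n} (hj : d j = 1) : ‖a‖ = 1 := by
  have h1 := Matrix.l2_opNorm_conjTranspose_mul_self a
  have h2 : ‖d‖ = 1 := by
    refine le_antisymm ((pi_norm_le_iff_of_nonneg zero_le_one).2 hd) ?_
    have := norm_le_pi_norm d j
    rwa [hj, norm_one] at this
  rw [h, Matrix.l2_opNorm_diagonal, h2] at h1
  nlinarith [norm_nonneg a]

theorem norm_shiftMat {n : ℕ} (hn : 2 ≤ n) {t : ℝ} (ht : t ∈ Set.Icc (0 : ℝ) 1) :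
    ‖shiftMat n t‖ = 1 := by
  have h : (shiftMat n t).conjTranspose * shiftMat n t = Matrix.diagonal fun j : Fin n =>
      if j.val = 0 then 0 else if j.val = 1 then 1 else ((t ^ 2 : ℝ) : ℂ) := by
    ext i j
    rw [Matrix.mul_apply, Matrix.diagonal_apply]
    simp only [shiftMat, Matrix.conjTranspose_apply, Matrix.of_apply]
    by_cases hj : j.val = 0
    · rw [Finset.sum_eq_zero fun k _ => by rw [if_neg (c := k.val + 1 = j.val) (by omega), mul_zero]]
      by_cases hij : i = j
      · simp [hij, hj]
      · simp [hij]
    · rw [Finset.sum_eq_single (⟨j.val - 1, by omega⟩ : Fin n)]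
      · have e : j.val - 1 + 1 = j.val := by omega
        by_cases hij : i = j
        · subst hij
          by_cases h1 : i.val = 1
          · simp [h1]
          · have h2 : ¬ (i.val - 1 = 0) := by omega
            simp [e, hj, h1, h2, sq]
        · have h3 : ¬ (j.val = i.val) := fun h => hij (Fin.ext h.symm)
          simp [e, hij, h3]
      · intro k _ hk
        rw [if_neg (c := k.val + 1 = j.val) (fun h => hk (Fin.ext (by simp; omega))), mul_zero]
      · simp
  refine norm_eq_one_of_conjTranspose_mul_self_eq_diagonal h (fun k => ?_)
    (j := ⟨1, by omega⟩) (by simp)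
  split_ifs
  · simp
  · simp
  · rw [Complex.norm_real, Real.norm_of_nonneg (sq_nonneg t)]
    exact pow_le_one₀ ht.1 ht.2

theorem norm_cornerMat {t : ℝ} (ht : t ∈ Set.Icc (0 : ℝ) 1) : ‖cornerMat t‖ = 1 := by
  have h : (cornerMat t).conjTranspose * cornerMat t = Matrix.diagonal ![0, 1] := by
    have e : ((√(1 - t) : ℝ) : ℂ) * (√(1 - t) : ℝ) + ((√t : ℝ) : ℂ) * (√t : ℝ) = 1 := by
      rw [← Complex.ofReal_mul, ← Complex.ofReal_mul, Real.mul_self_sqrt (sub_nonneg.2 ht.2),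
        Real.mul_self_sqrt ht.1]
      simp
    ext i j
    fin_cases i <;> fin_cases j <;>
      simp [cornerMat, Matrix.mul_apply, Fin.sum_univ_two, e]
  refine norm_eq_one_of_conjTranspose_mul_self_eq_diagonal h (fun k => ?_) (j := 1) rfl
  fin_cases k <;> simp

theorem sum_norm_sq_single {n : ℕ} (j : Fin n) :
    ∑ k, ‖(Pi.single j 1 : Fin n → ℂ) k‖ ^ 2 = 1 := by
  rw [Finset.sum_eq_single j]
  · simp
  · intro k _ hk
    simp [hk]
  · simp

theorem shiftMat_mulVec_single {n : ℕ} (hn : 2 ≤ n) (t : ℝ) :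
    (shiftMat n t).mulVec (Pi.single ⟨1, by omega⟩ 1) = Pi.single ⟨0, by omega⟩ 1 := by
  ext k
  rw [Matrix.mulVec_single_one, Matrix.col_apply, shiftMat, Matrix.of_apply, Pi.single_apply]
  by_cases hk : k.val = 0
  · simp [hk, Fin.ext_iff]
  · simp [hk, Fin.ext_iff]

theorem sum_norm_sq_cornerMat_mulVec_single {t : ℝ} (ht : t ∈ Set.Icc (0 : ℝ) 1) :
    ∑ k, ‖(cornerMat t).mulVec (Pi.single 1 1) k‖ ^ 2 = 1 := by
  rw [Fin.sum_univ_two, Matrix.mulVec_single_one]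
  simp [cornerMat, Matrix.col_apply, Real.sq_sqrt (sub_nonneg.2 ht.2), Real.sq_sqrt ht.1]

theorem shiftMat_zero {n : ℕ} (hn : 2 ≤ n) :
    shiftMat n 0 = Matrix.single ⟨0, by omega⟩ ⟨1, by omega⟩ 1 := by
  ext i j
  rw [shiftMat, Matrix.of_apply, Matrix.single_apply]
  simp only [Fin.ext_iff, Complex.ofReal_zero]
  split_ifs <;> first | rfl | omega

theorem cornerMat_zero : cornerMat 0 = Matrix.single 0 1 1 := by
  ext i j
  fin_cases i <;> fin_cases j <;> simp [cornerMat]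

theorem continuous_shiftMat (n : ℕ) : Continuous (shiftMat n) := by
  refine continuous_matrix fun i j => ?_
  simp only [shiftMat, Matrix.of_apply]
  split_ifs <;> fun_prop

theorem continuous_cornerMat : Continuous cornerMat := by
  refine continuous_matrix fun i j => ?_
  fin_cases i <;> fin_cases j <;> simp [cornerMat] <;> fun_prop

/-- The recurrence `sin (k+2)θ + sin kθ = 2 cos θ sin (k+1)θ`, multiplied by `sin (k+1)θ` and
summed, gives two sums on the left; they agree because `sin 0` and `sin (n+1)θ` vanish. -/
theorem sum_sin_mul_sin_succ (n : ℕ) :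
    ∑ k : Fin n, Real.sin ((k.val + 1) * (Real.pi / (n + 1))) *
        Real.sin ((k.val + 2) * (Real.pi / (n + 1))) =
      Real.cos (Real.pi / (n + 1)) *
        ∑ k : Fin n, Real.sin ((k.val + 1) * (Real.pi / (n + 1))) ^ 2 := by
  set θ := Real.pi / (n + 1) with hθ
  have hend : Real.sin (((n : ℝ) + 1) * θ) = 0 := by
    rw [hθ, mul_div_cancel₀ _ (by positivity), Real.sin_pi]
  have hrec (k : ℕ) : Real.sin ((k + 2) * θ) + Real.sin (k * θ) =
      2 * Real.cos θ * Real.sin ((k + 1) * θ) := by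
    rw [show ((k : ℝ) + 2) * θ = (k + 1) * θ + θ by ring,
      show (k : ℝ) * θ = (k + 1) * θ - θ by ring, Real.sin_add, Real.sin_sub]
    ring
  have htel := Finset.sum_range_sub
    (fun k : ℕ => Real.sin ((k : ℝ) * θ) * Real.sin ((k + 1) * θ)) n
  simp only [hend, mul_zero, CharP.cast_eq_zero, zero_mul, Real.sin_zero, sub_zero] at htel
  rw [Finset.sum_sub_distrib, sub_eq_zero] at htel
  have hsum : ∑ k ∈ Finset.range n, Real.sin ((k + 1) * θ) * Real.sin ((k + 2) * θ) +
      ∑ k ∈ Finset.range n, Real.sin (k * θ) * Real.sin ((k + 1) * θ) =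
      2 * Real.cos θ * ∑ k ∈ Finset.range n, Real.sin ((k + 1) * θ) ^ 2 := by
    rw [← Finset.sum_add_distrib, Finset.mul_sum]
    refine Finset.sum_congr rfl fun k _ => ?_
    linear_combination Real.sin ((k + 1) * θ) * hrec k
  have hshift : ∑ k ∈ Finset.range n, Real.sin (((k + 1 : ℕ) : ℝ) * θ) *
      Real.sin ((((k + 1 : ℕ) : ℝ) + 1) * θ) =
      ∑ k ∈ Finset.range n, Real.sin ((k + 1) * θ) * Real.sin ((k + 2) * θ) := by
    refine Finset.sum_congr rfl fun k _ => ?_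
    push_cast
    rw [show (k : ℝ) + 1 + 1 = k + 2 by ring]
  rw [hshift] at htel
  rw [Fin.sum_univ_eq_sum_range
    (fun k : ℕ => Real.sin ((k + 1) * θ) * Real.sin ((k + 2) * θ)) n,
    Fin.sum_univ_eq_sum_range (fun k : ℕ => Real.sin ((k + 1) * θ) ^ 2) n]
  linarith

variable {H : Type*} [NormedAddCommGroup H] [InnerProductSpace ℂ H]

theorem cos_mul_numRadius_le {n : ℕ} (hn : 1 ≤ n) (T : H →L[ℂ] H) :
    Real.cos (Real.pi / (n + 1)) * numRadius T ≤ numRadius (tensorRight (shiftMat n 1) T) := by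
  set θ := Real.pi / (n + 1) with hθ
  -- An eigenvector of the real part of the shift for the eigenvalue `cos θ`.
  let v : Fin n → ℂ := fun k => (Real.sin ((k.val + 1) * θ) : ℂ)
  have hv : ∑ k, ‖v k‖ ^ 2 = ∑ k : Fin n, Real.sin ((k.val + 1) * θ) ^ 2 := by
    refine Finset.sum_congr rfl fun k _ => ?_
    rw [Complex.norm_real, Real.norm_eq_abs, sq_abs]
  have hmul (k : Fin n) : (shiftMat n 1).mulVec v k = (Real.sin ((k.val + 2) * θ) : ℂ) := by
    rw [Matrix.mulVec, dotProduct]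
    by_cases hk : k.val + 1 < n
    · rw [Finset.sum_eq_single (⟨k.val + 1, hk⟩ : Fin n)]
      · simp only [shiftMat, Matrix.of_apply, v]
        push_cast
        rw [add_assoc, one_add_one_eq_two]
        simp
      · intro j _ hj
        have : k.val + 1 ≠ j.val := fun h => hj (Fin.ext h.symm)
        simp [shiftMat, this]
      · simp
    -- The last row of the shift is zero, in agreement with `sin ((n + 1) θ) = sin π = 0`.
    · have e : (k.val : ℝ) + 2 = n + 1 := by
        have : ((k.val + 1 : ℕ) : ℝ) = n := by congr 1; omega
        push_cast at this
        linarith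
      rw [e, hθ, mul_div_cancel₀ _ (by positivity), Real.sin_pi, Complex.ofReal_zero]
      refine Finset.sum_eq_zero fun j _ => ?_
      have : k.val + 1 ≠ j.val := by omega
      simp [shiftMat, this]
  have hdot : star v ⬝ᵥ (shiftMat n 1).mulVec v =
      ((Real.cos θ * ∑ k : Fin n, Real.sin ((k.val + 1) * θ) ^ 2 : ℝ) : ℂ) := by
    rw [hθ, ← sum_sin_mul_sin_succ, ← hθ, dotProduct, Complex.ofReal_sum]
    refine Finset.sum_congr rfl fun k _ => ?_
    rw [hmul, Pi.star_apply, RCLike.star_def, Complex.conj_ofReal, Complex.ofReal_mul]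
  have hpos : 0 < ∑ k : Fin n, Real.sin ((k.val + 1) * θ) ^ 2 := by
    refine Finset.sum_pos' (fun k _ => sq_nonneg _) ⟨⟨0, hn⟩, Finset.mem_univ _, ?_⟩
    have : 0 < Real.sin θ := by
      apply Real.sin_pos_of_pos_of_lt_pi (by positivity)
      rw [hθ]
      apply div_lt_self Real.pi_pos
      have : (1 : ℝ) ≤ n := by exact_mod_cast hn
      linarith
    simpa using pow_pos this 2
  refine le_trans ?_ (norm_dotProduct_mul_numRadius_le (shiftMat n 1) v (by rw [hv]; exact hpos.ne') T)
  rw [hdot, hv, Complex.norm_real]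
  refine mul_le_mul_of_nonneg_right ?_ (numRadius_nonneg T)
  rw [le_div_iff₀ hpos]
  exact le_abs_self _

theorem numRadius_le_cornerMat_one (T : H →L[ℂ] H) :
    numRadius T ≤ numRadius (tensorRight (cornerMat 1) T) := by
  have h := norm_dotProduct_mul_numRadius_le (cornerMat 1) (Pi.single 1 1)
    (by rw [sum_norm_sq_single]; exact one_ne_zero) T
  rw [sum_norm_sq_single] at h
  simpa [Matrix.mulVec_single_one, cornerMat, dotProduct, Fin.sum_univ_two, Pi.single_apply] using h

/-- Evaluation at one `x` maps the family onto a set containing a nondegenerate interval, by the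
intermediate value theorem. -/
theorem not_countable_image_Icc {X : Type*} {F : ℝ → MatFun X} {m : ℕ} {x : Matrix (Fin m) (Fin m) X}
    (hF : ContinuousOn (fun t => F t m x) (Set.Icc 0 1)) (h : F 0 m x < F 1 m x) :
    ¬ (F '' Set.Icc (0 : ℝ) 1).Countable := by
  intro hc
  have h1 := hc.image fun W => W m x
  rw [Set.image_image] at h1
  have h2 := h1.mono (intermediate_value_Icc zero_le_one hF)
  rw [Cardinal.Real.Icc_countable_iff] at h2
  exact h2.not_gt h

variable {X : Type*} [AddCommGroup X] [Module ℂ X]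

theorem exists_fin_one_pos {O : MatFun X} (hO : IsOperatorSpace O) [Nontrivial X] :
    ∃ x : Matrix (Fin 1) (Fin 1) X, 0 < O 1 x := by
  obtain ⟨v, hv⟩ := exists_ne (0 : X)
  exact ⟨Matrix.of fun _ _ => v, hO.isNorm.pos fun h => hv (congrFun (congrFun h 0) 0)⟩

end Paths

/-! ### Separating functionals for `Wmax` -/

section Functionals

variable {X : Type*} [AddCommGroup X] [Module ℂ X] {O : MatFun X}

/-- The block row `[a, b]`. -/
def blockRow {m p q : ℕ} (a : Matrix (Fin m) (Fin p) ℂ) (b : Matrix (Fin m) (Fin q) ℂ) :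
    Matrix (Fin m) (Fin (p + q)) ℂ := Matrix.of fun i => Fin.append (a i) (b i)

theorem blockRow_mul_conjTranspose {m p q : ℕ} (a : Matrix (Fin m) (Fin p) ℂ)
    (b : Matrix (Fin m) (Fin q) ℂ) :
    blockRow a b * (blockRow a b).conjTranspose = a * a.conjTranspose + b * b.conjTranspose := by
  ext i j
  simp [blockRow, Matrix.mul_apply, Fin.sum_univ_add]

theorem sandwich_blockRow {m p q : ℕ} (a : Matrix (Fin m) (Fin p) ℂ)
    (a' : Matrix (Fin m) (Fin q) ℂ) (y : Matrix (Fin p) (Fin p) X) (z : Matrix (Fin q) (Fin q) X)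
    (b : Matrix (Fin p) (Fin m) ℂ) (b' : Matrix (Fin q) (Fin m) ℂ) :
    sandwich (blockRow a a') (diagBlock y z)
      (blockRow b.conjTranspose b'.conjTranspose).conjTranspose =
      sandwich a y b + sandwich a' z b' := by
  ext i j
  simp [blockRow, sandwich_apply, Fin.sum_univ_add]

/-- The condition that `(x, h)` lies in the cone generated by the pairs
`(a y b, (a a* + b* b) / 2)` with `O y ≤ 1`, up to a positive error in the real part of `h`. -/
def Dominates (O : MatFun X) {m : ℕ} (x : Matrix (Fin m) (Fin m) X)
    (h : Matrix (Fin m) (Fin m) ℂ) : Prop :=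
  ∃ (r : ℕ) (a : Matrix (Fin m) (Fin r) ℂ) (y : Matrix (Fin r) (Fin r) X)
    (b : Matrix (Fin r) (Fin m) ℂ), x = sandwich a y b ∧ O r y ≤ 1 ∧
      a * a.conjTranspose + b.conjTranspose * b ≤ h + h.conjTranspose

/-- Factorizations add by placing the outer factors side by side around `y ⊕ y'`; the maximum axiom
keeps the middle factor in the unit ball. -/
theorem Dominates.add (hO : IsOperatorSpace O) {m : ℕ} {x x' : Matrix (Fin m) (Fin m) X}
    {h h' : Matrix (Fin m) (Fin m) ℂ} (hx : Dominates O x h) (hx' : Dominates O x' h') :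
    Dominates O (x + x') (h + h') := by
  obtain ⟨r, a, y, b, rfl, hy, hab⟩ := hx
  obtain ⟨r', a', y', b', rfl, hy', hab'⟩ := hx'
  refine ⟨r + r', blockRow a a', diagBlock y y', _, (sandwich_blockRow a a' y y' b b').symm, ?_, ?_⟩
  · rw [hO.diag_eq]; exact max_le hy hy'
  · rw [Matrix.conjTranspose_conjTranspose, blockRow_mul_conjTranspose,
      blockRow_mul_conjTranspose, Matrix.conjTranspose_conjTranspose,
      Matrix.conjTranspose_conjTranspose, Matrix.conjTranspose_add]
    calc _ = (a * a.conjTranspose + b.conjTranspose * b) +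
          (a' * a'.conjTranspose + b'.conjTranspose * b') := by abel
      _ ≤ (h + h.conjTranspose) + (h' + h'.conjTranspose) := add_le_add hab hab'
      _ = _ := by abel

theorem real_smul_eq_complex_smul {m : ℕ} (c : ℝ) (x : Matrix (Fin m) (Fin m) X) :
    c • x = (c : ℂ) • x := by
  ext i j; rfl

theorem Dominates.smul {m : ℕ} {x : Matrix (Fin m) (Fin m) X}
    {h : Matrix (Fin m) (Fin m) ℂ} (hx : Dominates O x h) {c : ℝ} (hc : 0 ≤ c) :
    Dominates O (c • x) (c • h) := by
  obtain ⟨r, a, y, b, rfl, hy, hab⟩ := hx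
  refine ⟨r, ((√c : ℝ) : ℂ) • a, y, ((√c : ℝ) : ℂ) • b, ?_, hy, ?_⟩
  · rw [sandwich_sqrt_smul hc, real_smul_eq_complex_smul]
  · rw [sqrt_smul_mul_conjTranspose_add hc, real_smul_eq_complex_smul,
      conjTranspose_ofReal_smul, ← smul_add]
    rw [← real_smul_eq_complex_smul, ← real_smul_eq_complex_smul]
    exact smul_le_smul_of_nonneg_left hab hc

theorem dominates_zero (hO : IsOperatorSpace O) {m : ℕ} {h : Matrix (Fin m) (Fin m) ℂ}
    (hh : 0 ≤ h + h.conjTranspose) : Dominates O (0 : Matrix (Fin m) (Fin m) X) h :=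
  ⟨m, 0, 0, 0, by simp, by rw [hO.isNorm.zero]; exact zero_le_one, by simpa using hh⟩

theorem Wmax_le_of_dominates (hO : IsOperatorSpace O) {m : ℕ} (hm : m ≠ 0)
    {x : Matrix (Fin m) (Fin m) X} {s l : ℝ} (hl : 0 ≤ l)
    (hx : Dominates O (l • x) (s • (1 : Matrix (Fin m) (Fin m) ℂ))) : l * Wmax O m x ≤ s := by
  obtain ⟨r, a, y, b, hxy, hy, hab⟩ := hx
  have e : s • (1 : Matrix (Fin m) (Fin m) ℂ) + (s • (1 : Matrix (Fin m) (Fin m) ℂ)).conjTranspose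
      = (2 * s) • 1 := by
    rw [real_smul_eq_complex_smul, conjTranspose_ofReal_smul, Matrix.conjTranspose_one,
      ← real_smul_eq_complex_smul, ← add_smul, two_mul]
  rw [e] at hab
  have : NeZero m := ⟨hm⟩
  have h0 : 0 ≤ a * a.conjTranspose + b.conjTranspose * b :=
    add_nonneg (Matrix.posSemidef_self_mul_conjTranspose a).nonneg
      (Matrix.posSemidef_conjTranspose_mul_self b).nonneg
  have hs : 0 ≤ 2 * s := by
    -- The sign of `s` is read off a diagonal entry, which exists since `m ≠ 0`.
    have h := (Matrix.nonneg_iff_posSemidef.1 (h0.trans hab)).diag_nonneg (i := 0)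
    have h' : (0 : ℂ) ≤ ((2 * s : ℝ) : ℂ) := by simpa using h
    exact_mod_cast h'
  have hn := CStarAlgebra.norm_le_norm_of_nonneg_of_le h0 hab
  rw [norm_smul, Real.norm_of_nonneg hs, CStarRing.norm_one, mul_one] at hn
  have h1 := Wmax_sandwich_le hO.isNorm a (((l⁻¹ : ℝ) : ℂ) • y) b
  rcases hl.eq_or_lt with rfl | hl
  · linarith
  rw [sandwich_smul_middle, ← hxy, real_smul_eq_complex_smul, smul_smul, ← Complex.ofReal_mul,
    inv_mul_cancel₀ hl.ne', Complex.ofReal_one, one_smul, hO.isNorm.smul_eq, Complex.norm_real,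
    Real.norm_of_nonneg (inv_nonneg.2 hl.le)] at h1
  have h2 : l * Wmax O m x ≤ 1 / 2 * ‖a * a.conjTranspose + b.conjTranspose * b‖ * O r y := by
    calc l * Wmax O m x ≤ l * (1 / 2 * ‖a * a.conjTranspose + b.conjTranspose * b‖ *
          (l⁻¹ * O r y)) := by gcongr
      _ = _ := by field_simp
  have h3 : 1 / 2 * ‖a * a.conjTranspose + b.conjTranspose * b‖ * O r y ≤ 1 / 2 * (2 * s) * 1 := by
    have := hO.isNorm.nonneg y
    gcongr
  linarith

theorem exists_dominates (hO : IsOperatorSpace O) {m : ℕ} (x : Matrix (Fin m) (Fin m) X)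
    (h : Matrix (Fin m) (Fin m) ℂ) :
    ∃ t : ℝ, Dominates O x (t • (1 : Matrix (Fin m) (Fin m) ℂ) + h) := by
  have hx := hO.isNorm.nonneg x
  have hN : (0 : ℝ) < O m x + 1 := by linarith
  set N := O m x + 1 with hNdef
  have hN' : (N : ℂ) ≠ 0 := Complex.ofReal_ne_zero.2 hN.ne'
  -- The factorization `(N 1)(N⁻¹ x) 1` costs `aa* + b*b = (N² + 1) 1`, and `‖h + h*‖` absorbs the
  -- given `h`. Taking `N = O x + 1` keeps `N` invertible when `x = 0`.
  refine ⟨(N ^ 2 + 1 + ‖h + h.conjTranspose‖) / 2, m, (N : ℂ) • 1, (N : ℂ)⁻¹ • x, 1, ?_, ?_, ?_⟩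
  · rw [sandwich_smul_left, sandwich_smul_middle, sandwich_one_one, smul_smul,
      mul_inv_cancel₀ hN', one_smul]
  · rw [hO.isNorm.smul_eq, norm_inv, Complex.norm_real, Real.norm_of_nonneg hN.le,
      inv_mul_le_one₀ hN]
    linarith
  · have hsa : IsSelfAdjoint (h + h.conjTranspose) := Matrix.isHermitian_add_transpose_self h
    have h1 := hsa.neg_algebraMap_norm_le_self
    rw [Algebra.algebraMap_eq_smul_one] at h1
    have e1 : (N : ℂ) • (1 : Matrix (Fin m) (Fin m) ℂ) * ((N : ℂ) • 1 :
        Matrix (Fin m) (Fin m) ℂ).conjTranspose + (1 : Matrix (Fin m) (Fin m) ℂ).conjTranspose * 1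
        = (N ^ 2 + 1) • 1 := by
      rw [conjTranspose_ofReal_smul, Matrix.conjTranspose_one, Matrix.smul_mul, Matrix.mul_smul,
        Matrix.one_mul, ← real_smul_eq_complex_smul, ← real_smul_eq_complex_smul, smul_smul,
        add_smul, one_smul, sq]
    rw [e1]
    set t := (N ^ 2 + 1 + ‖h + h.conjTranspose‖) / 2 with ht
    have e2 : t • (1 : Matrix (Fin m) (Fin m) ℂ) + h +
        (t • (1 : Matrix (Fin m) (Fin m) ℂ) + h).conjTranspose =
        (N ^ 2 + 1) • 1 + (‖h + h.conjTranspose‖ • 1 + (h + h.conjTranspose)) := by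
      have e3 : (t • (1 : Matrix (Fin m) (Fin m) ℂ)).conjTranspose = t • 1 := by
        rw [real_smul_eq_complex_smul, conjTranspose_ofReal_smul, Matrix.conjTranspose_one]
      have e4 : (N ^ 2 + 1) • (1 : Matrix (Fin m) (Fin m) ℂ) + ‖h + h.conjTranspose‖ • 1 =
          t • 1 + t • 1 := by
        rw [← add_smul, ← add_smul, ht, add_halves]
      rw [Matrix.conjTranspose_add, e3,
        ← add_assoc ((N ^ 2 + 1) • (1 : Matrix (Fin m) (Fin m) ℂ)), e4]
      abel
    rw [e2]
    exact le_add_of_nonneg_right (neg_le_iff_add_nonneg'.1 h1)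

/-- The cone of all `(x, h)` such that `(x + l x₀, h + l c)` is dominated for some `l ≥ 0`. -/
def dominationCone (hO : IsOperatorSpace O) {m : ℕ} (x₀ : Matrix (Fin m) (Fin m) X) (c : ℝ) :
    PointedCone ℝ (Matrix (Fin m) (Fin m) X × Matrix (Fin m) (Fin m) ℂ) where
  carrier := {v | ∃ l : ℝ, 0 ≤ l ∧
    Dominates O (v.1 + l • x₀) (v.2 + l • c • (1 : Matrix (Fin m) (Fin m) ℂ))}
  zero_mem' := ⟨0, le_rfl, by simpa using dominates_zero hO (by simp)⟩
  add_mem' := by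
    rintro v w ⟨l, hl, hv⟩ ⟨l', hl', hw⟩
    refine ⟨l + l', add_nonneg hl hl', ?_⟩
    have h := hv.add hO hw
    rw [add_add_add_comm, add_add_add_comm v.2, ← add_smul, ← add_smul] at h
    exact h
  smul_mem' := by
    rintro ⟨k, hk⟩ v ⟨l, hl, hv⟩
    refine ⟨k * l, mul_nonneg hk hl, ?_⟩
    have h := hv.smul hk
    rw [smul_add, smul_add, smul_smul, smul_smul] at h
    exact h

/-- The functional `t (0, 1) ↦ t` is extended to one, `g`, that is nonnegative on `dominationCone`.
Its components are `Re f = -g(·, 0)` and `p = g(0, ·)`, so dominated pairs satisfy `Re f(x) ≤ p(h)`.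
Adding the direction `(-x₀, -c)` to the cone forces `c ≤ Re f(x₀)`; the hypothesis on `c` keeps the
cone compatible with the initial functional. -/
theorem exists_functionals (hO : IsOperatorSpace O) {m : ℕ} (hm : m ≠ 0)
    {x₀ : Matrix (Fin m) (Fin m) X} {c : ℝ} (hc : c < Wmax O m x₀) :
    ∃ (f : Matrix (Fin m) (Fin m) X →ₗ[ℂ] ℂ) (p : Matrix (Fin m) (Fin m) ℂ →ₗ[ℝ] ℝ),
      p 1 = 1 ∧ (∀ h, 0 ≤ h + h.conjTranspose → 0 ≤ p h) ∧ c ≤ ‖f x₀‖ ∧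
      ∀ (r : ℕ) (a : Matrix (Fin m) (Fin r) ℂ) (y : Matrix (Fin r) (Fin r) X)
        (b : Matrix (Fin r) (Fin m) ℂ),
        ‖f (sandwich a y b)‖ ≤
          1 / 2 * O r y * p (a * a.conjTranspose + b.conjTranspose * b) := by
  have : NeZero m := ⟨hm⟩
  have he : ((0, 1) : Matrix (Fin m) (Fin m) X × Matrix (Fin m) (Fin m) ℂ) ≠ 0 := fun h =>
    one_ne_zero (congrArg Prod.snd h)
  obtain ⟨g, hg1, hg⟩ := riesz_extension (dominationCone hO x₀ c)
    (LinearPMap.mkSpanSingleton (K := ℝ) (L := ℝ) (σ := RingHom.id ℝ) _ (1 : ℝ) he) (by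
      rintro ⟨v, hv⟩ hmem
      obtain ⟨t, rfl⟩ := Submodule.mem_span_singleton.1 hv
      rw [LinearPMap.mkSpanSingleton'_apply]
      obtain ⟨l, hl, hdom⟩ := hmem
      -- Membership of `(0, t)` gives `l Wmax(x₀) ≤ t + l c`, and `c < Wmax(x₀)` then yields `t ≥
      -- 0`.
      have h1 : Dominates O (l • x₀) ((t + l * c) • (1 : Matrix (Fin m) (Fin m) ℂ)) := by
        simpa [add_smul, smul_smul] using hdom
      have h2 := Wmax_le_of_dominates hO hm hl h1
      have h3 : l * c ≤ l * Wmax O m x₀ := by gcongr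
      simp only [RingHom.id_apply, smul_eq_mul, mul_one]
      linarith) (by
      intro v
      obtain ⟨t, ht⟩ := exists_dominates hO v.1 v.2
      refine ⟨⟨t • ((0, 1) : Matrix (Fin m) (Fin m) X × Matrix (Fin m) (Fin m) ℂ),
        Submodule.mem_span_singleton.2 ⟨t, rfl⟩⟩, 0, le_rfl, ?_⟩
      simpa using ht)
  have hge : g (0, 1) = 1 := by
    rw [hg1 ⟨_, Submodule.mem_span_singleton_self _⟩]
    exact LinearPMap.mkSpanSingleton_apply ℝ ℝ he 1
  have hdom {x : Matrix (Fin m) (Fin m) X} {h : Matrix (Fin m) (Fin m) ℂ}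
      (hxh : Dominates O x h) : 0 ≤ g (x, 0) + g (0, h) := by
    rw [← map_add, Prod.mk_add_mk, add_zero, zero_add]
    exact hg _ ⟨0, le_rfl, by simpa using hxh⟩
  let fr : Matrix (Fin m) (Fin m) X →ₗ[ℝ] ℝ := -(g ∘ₗ LinearMap.inl ℝ _ _)
  let p : Matrix (Fin m) (Fin m) ℂ →ₗ[ℝ] ℝ := g ∘ₗ LinearMap.inr ℝ _ _
  let f : Matrix (Fin m) (Fin m) X →ₗ[ℂ] ℂ := Module.Dual.extendRCLike (𝕜 := ℂ) fr
  have hfre (x) : (f x).re = -g (x, 0) := Module.Dual.re_extendRCLike_apply (𝕜 := ℂ) fr x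
  have hpe (h) : p h = g (0, h) := rfl
  have hone : ∀ (r : ℕ) (a : Matrix (Fin m) (Fin r) ℂ) (y : Matrix (Fin r) (Fin r) X)
        (b : Matrix (Fin r) (Fin m) ℂ), O r y ≤ 1 →
        ‖f (sandwich a y b)‖ ≤ 1 / 2 * p (a * a.conjTranspose + b.conjTranspose * b) := by
    intro r a y b hy
    -- A phase put on `a` makes the value of `f` real and nonnegative without changing `aa*`, so the
    -- bound on `Re f` becomes one on `‖f‖`.
    obtain ⟨z, hz, hzf⟩ := RCLike.exists_norm_eq_mul_self (f (sandwich a y b))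
    have hzz : (z • a) * (z • a).conjTranspose = a * a.conjTranspose := by
      rw [Matrix.conjTranspose_smul, Matrix.smul_mul, Matrix.mul_smul, smul_smul, RCLike.star_def,
        RCLike.mul_conj, hz]
      simp
    have hD : Dominates O (sandwich (z • a) y b)
        ((1 / 2 : ℝ) • (a * a.conjTranspose + b.conjTranspose * b)) := by
      refine ⟨r, z • a, y, b, rfl, hy, le_of_eq ?_⟩
      rw [hzz, real_smul_eq_complex_smul, conjTranspose_ofReal_smul, Matrix.conjTranspose_add,
        Matrix.conjTranspose_mul, Matrix.conjTranspose_mul, Matrix.conjTranspose_conjTranspose,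
        Matrix.conjTranspose_conjTranspose, ← add_smul]
      norm_num
    have h1 := hdom hD
    have h2 : (f (sandwich (z • a) y b)).re = ‖f (sandwich a y b)‖ := by
      rw [sandwich_smul_left, map_smul, smul_eq_mul, ← hzf]
      exact Complex.ofReal_re _
    rw [hfre] at h2
    rw [← hpe, map_smul, smul_eq_mul] at h1
    linarith
  refine ⟨f, p, hge, fun h hh => ?_, ?_, fun r a y b => ?_⟩
  · have h1 := hdom (dominates_zero hO hh)
    rwa [← Prod.zero_eq_mk, map_zero, zero_add] at h1
  · have h1 := hg (-x₀, -(c • (1 : Matrix (Fin m) (Fin m) ℂ)))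
      ⟨1, zero_le_one, by simpa using dominates_zero hO (by simp)⟩
    have h2 : ((-x₀, -(c • (1 : Matrix (Fin m) (Fin m) ℂ))) :
        Matrix (Fin m) (Fin m) X × Matrix (Fin m) (Fin m) ℂ) = -((x₀, 0) + c • (0, 1)) := by
      simp
    rw [h2, map_neg, map_add, map_smul, hge, smul_eq_mul, mul_one] at h1
    calc c ≤ (f x₀).re := by rw [hfre]; linarith
      _ ≤ ‖f x₀‖ := Complex.re_le_norm _
  · by_cases hy : y = 0
    · rw [hy, sandwich_zero_middle, map_zero, norm_zero, hO.isNorm.zero]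
      simp
    obtain ⟨z, hz, hyz⟩ := hO.isNorm.exists_eq_smul hy
    have h1 := hone r a z b hz.le
    have h2 : ‖f (sandwich a y b)‖ = O r y * ‖f (sandwich a z b)‖ := by
      conv_lhs => rw [hyz, sandwich_smul_middle, map_smul, norm_smul, Complex.norm_real,
        Real.norm_of_nonneg (hO.isNorm.nonneg y)]
    rw [h2]
    calc O r y * ‖f (sandwich a z b)‖ ≤
        O r y * (1 / 2 * p (a * a.conjTranspose + b.conjTranspose * b)) := by
          have := hO.isNorm.nonneg y
          gcongr
      _ = _ := by ring

end Functionals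

/-! ### Positive functionals as squares of matrices -/

section Gram

variable {m : ℕ}

/-- The matrix of the complexification of a real functional on complex matrices. -/
def gramMatrix (p : Matrix (Fin m) (Fin m) ℂ →ₗ[ℝ] ℝ) : Matrix (Fin m) (Fin m) ℂ :=
  Matrix.of fun i j => Module.Dual.extendRCLike (𝕜 := ℂ) p (Matrix.single i j 1)

theorem extendRCLike_eq_sum (p : Matrix (Fin m) (Fin m) ℂ →ₗ[ℝ] ℝ)
    (h : Matrix (Fin m) (Fin m) ℂ) :
    Module.Dual.extendRCLike (𝕜 := ℂ) p h = ∑ i, ∑ j, h i j * gramMatrix p i j := by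
  conv_lhs => rw [Matrix.matrix_eq_sum_single h]
  simp only [map_sum]
  refine Finset.sum_congr rfl fun i _ => Finset.sum_congr rfl fun j _ => ?_
  rw [gramMatrix, Matrix.of_apply, ← smul_eq_mul, ← map_smul, Matrix.smul_single, smul_eq_mul,
    mul_one]

theorem extendRCLike_vecMulVec (p : Matrix (Fin m) (Fin m) ℂ →ₗ[ℝ] ℝ) (v : Fin m → ℂ) :
    Module.Dual.extendRCLike (𝕜 := ℂ) p (Matrix.vecMulVec (star v) v) =
      star v ⬝ᵥ (gramMatrix p).mulVec v := by
  rw [extendRCLike_eq_sum, dotProduct]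
  refine Finset.sum_congr rfl fun i _ => ?_
  rw [Matrix.mulVec, dotProduct, Finset.mul_sum]
  refine Finset.sum_congr rfl fun j _ => ?_
  rw [Matrix.vecMulVec_apply]
  ring

/-- For skew-adjoint `h` both `h` and `-h` satisfy the hypothesis, so `p` vanishes on them and is
invariant under adjoints; this makes the Gram matrix Hermitian. Positivity is tested on rank-one
matrices. -/
theorem posSemidef_gramMatrix {p : Matrix (Fin m) (Fin m) ℂ →ₗ[ℝ] ℝ}
    (hp : ∀ h, 0 ≤ h + h.conjTranspose → 0 ≤ p h) : (gramMatrix p).PosSemidef := by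
  have hskew (h : Matrix (Fin m) (Fin m) ℂ) (hh : h + h.conjTranspose = 0) : p h = 0 := by
    have h1 := hp h hh.ge
    have h2 := hp (-h) (by rw [Matrix.conjTranspose_neg, ← neg_add, hh, neg_zero])
    rw [map_neg] at h2
    linarith
  have hconj (h : Matrix (Fin m) (Fin m) ℂ) : p h.conjTranspose = p h := by
    have h1 := hskew (h.conjTranspose - h) (by
      rw [Matrix.conjTranspose_sub, Matrix.conjTranspose_conjTranspose]; abel)
    rw [map_sub] at h1
    linarith
  refine Matrix.PosSemidef.of_dotProduct_mulVec_nonneg ?_ fun v => ?_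
  · ext i j
    have h1 := hconj (Matrix.single j i 1)
    have h2 := hconj (Complex.I • Matrix.single j i 1)
    rw [Matrix.conjTranspose_smul, RCLike.star_def, Complex.conj_I, neg_smul, map_neg] at h2
    rw [Matrix.conjTranspose_single, star_one] at h1 h2
    rw [Matrix.conjTranspose_apply, gramMatrix, Matrix.of_apply, Matrix.of_apply,
      Module.Dual.extendRCLike_apply, Module.Dual.extendRCLike_apply]
    apply Complex.ext
    · simp [h1]
    · simpa using h2.symm
  · rw [← extendRCLike_vecMulVec, Module.Dual.extendRCLike_apply]
    have hH : (Matrix.vecMulVec (star v) v).conjTranspose = Matrix.vecMulVec (star v) v := by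
      rw [Matrix.conjTranspose_vecMulVec, star_star]
    have h1 : p (Complex.I • Matrix.vecMulVec (star v) v) = 0 := hskew _ (by
      rw [Matrix.conjTranspose_smul, hH, RCLike.star_def, Complex.conj_I, neg_smul,
        add_neg_cancel])
    have h2 : 0 ≤ p (Matrix.vecMulVec (star v) v) := hp _ (by
      have hn : 0 ≤ Matrix.vecMulVec (star v) v :=
        (Matrix.posSemidef_vecMulVec_star_self v).nonneg
      rw [hH]
      exact add_nonneg hn hn)
    have h3 : (RCLike.I : ℂ) = Complex.I := rfl
    rw [h3, h1]
    simpa using h2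

theorem re_star_dotProduct_conjTranspose_mul_self (q : Matrix (Fin m) (Fin m) ℂ)
    (v : Fin m → ℂ) :
    (star v ⬝ᵥ (q.conjTranspose * q).mulVec v).re = ∑ i, ‖q.mulVec v i‖ ^ 2 := by
  rw [← Matrix.mulVec_mulVec, Matrix.dotProduct_mulVec, ← Matrix.star_mulVec, dotProduct,
    Complex.re_sum]
  refine Finset.sum_congr rfl fun i _ => ?_
  rw [Pi.star_apply, RCLike.star_def, RCLike.conj_mul]
  norm_cast

/-- The Gram matrix may be singular; adding `ε` makes it positive definite, so that its factor `q`
is invertible. -/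
theorem exists_dominating_square {p : Matrix (Fin m) (Fin m) ℂ →ₗ[ℝ] ℝ}
    (hp : ∀ h, 0 ≤ h + h.conjTranspose → 0 ≤ p h) {ε : ℝ} (hε : 0 < ε) :
    ∃ q : Matrix (Fin m) (Fin m) ℂ, IsUnit q ∧ ∀ v : Fin m → ℂ,
      ∑ i, ‖q.mulVec v i‖ ^ 2 = p (Matrix.vecMulVec (star v) v) + ε * ∑ i, ‖v i‖ ^ 2 := by
  have hε' : (0 : ℂ) < (ε : ℂ) := by exact_mod_cast hε
  have hpos : (gramMatrix p + (ε : ℂ) • 1).PosDef :=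
    Matrix.PosDef.posSemidef_add (posSemidef_gramMatrix hp) (Matrix.PosDef.one.smul hε')
  obtain ⟨q, hq⟩ := CStarAlgebra.nonneg_iff_eq_star_mul_self.1 hpos.posSemidef.nonneg
  refine ⟨q, ?_, fun v => ?_⟩
  · have h1 := hpos.isUnit
    rw [hq] at h1
    exact isUnit_of_mul_isUnit_right h1
  · rw [← re_star_dotProduct_conjTranspose_mul_self, ← Matrix.star_eq_conjTranspose, ← hq,
      Matrix.add_mulVec, dotProduct_add, ← extendRCLike_vecMulVec, Complex.add_re]
    congr 1
    · exact Module.Dual.re_extendRCLike_apply (𝕜 := ℂ) p _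
    · rw [Matrix.smul_mulVec, Matrix.one_mulVec, dotProduct_smul, smul_eq_mul,
        Complex.re_ofReal_mul]
      congr 1
      have := re_star_dotProduct_conjTranspose_mul_self (1 : Matrix (Fin m) (Fin m) ℂ) v
      simpa using this

end Gram

/-! ### From functionals to complete contractions into matrix algebras -/

section Realization

variable {X : Type*} [AddCommGroup X] [Module ℂ X] {O : MatFun X} {m : ℕ}

/-- The map `x ↦ q* F(x) q` into the operators on `ℂᵐ`, where the matrix `F(x)` represents the
sesquilinear form given by the functional `f`. -/
def formMap (f : Matrix (Fin m) (Fin m) X →ₗ[ℂ] ℂ) (q : Matrix (Fin m) (Fin m) ℂ) :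
    X →ₗ[ℂ] (HPow m ℂ →L[ℂ] HPow m ℂ) where
  toFun x := Matrix.toEuclideanCLM (n := Fin m) (𝕜 := ℂ)
    (q.conjTranspose * (Matrix.of fun i j => f (Matrix.single i j x)) * q)
  map_add' x y := by
    rw [← map_add, ← add_mul, ← mul_add]
    congr 3
    ext i j
    simp [Matrix.single_add]
  map_smul' c x := by
    rw [RingHom.id_apply, ← map_smul, ← Matrix.smul_mul, ← Matrix.mul_smul]
    congr 3
    ext i j
    simp [← Matrix.smul_single]

theorem inner_formMap (f : Matrix (Fin m) (Fin m) X →ₗ[ℂ] ℂ) (q : Matrix (Fin m) (Fin m) ℂ)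
    (x : X) (ξ η : HPow m ℂ) :
    inner ℂ η (formMap f q x ξ) =
      f (Matrix.of fun i j => (star (q.mulVec η i) * q.mulVec ξ j) • x) := by
  have h1 : inner ℂ η (formMap f q x ξ) = star (q.mulVec η) ⬝ᵥ
      (Matrix.of fun i j => f (Matrix.single i j x)).mulVec (q.mulVec ξ) := by
    rw [Matrix.star_mulVec, ← Matrix.dotProduct_mulVec, Matrix.mulVec_mulVec,
      Matrix.mulVec_mulVec, EuclideanSpace.inner_eq_star_dotProduct, dotProduct_comm]
    rfl
  rw [h1, dotProduct]
  conv_rhs => rw [Matrix.matrix_eq_sum_single (Matrix.of _)]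
  simp only [map_sum]
  refine Finset.sum_congr rfl fun i _ => ?_
  rw [Matrix.mulVec, dotProduct, Finset.mul_sum]
  refine Finset.sum_congr rfl fun j _ => ?_
  rw [Matrix.of_apply, Matrix.of_apply, ← Matrix.smul_single, map_smul, smul_eq_mul,
    Pi.star_apply]
  ring

/-- The matrix whose columns are the vectors `conj (q ζ_s)`. -/
def columnMatrix (q : Matrix (Fin m) (Fin m) ℂ) {r : ℕ} (ζ : HPow r (HPow m ℂ)) :
    Matrix (Fin m) (Fin r) ℂ := Matrix.of fun i s => star (q.mulVec (ζ s) i)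

/-- Every matrix coefficient of an amplification is a value of `f` at a sandwich product, so the
single estimate for `f` controls all matrix levels at once. -/
theorem inner_ampMap_formMap (f : Matrix (Fin m) (Fin m) X →ₗ[ℂ] ℂ)
    (q : Matrix (Fin m) (Fin m) ℂ) {r : ℕ} (y : Matrix (Fin r) (Fin r) X)
    (ξ η : HPow r (HPow m ℂ)) :
    inner ℂ η (ampMap (formMap f q) r y ξ) =
      f (sandwich (columnMatrix q η) y (columnMatrix q ξ).conjTranspose) := by
  rw [inner_ampMap]
  simp only [inner_formMap]
  simp only [← map_sum]
  congr 1
  ext i j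
  simp [Matrix.sum_apply, sandwich_apply, columnMatrix]

theorem columnMatrix_mul_conjTranspose (q : Matrix (Fin m) (Fin m) ℂ) {r : ℕ}
    (ζ : HPow r (HPow m ℂ)) :
    columnMatrix q ζ * (columnMatrix q ζ).conjTranspose =
      ∑ s, Matrix.vecMulVec (star (q.mulVec (ζ s))) (q.mulVec (ζ s)) := by
  ext i j
  simp [Matrix.mul_apply, columnMatrix, Matrix.sum_apply, Matrix.vecMulVec_apply]

theorem exists_isCompleteContraction_le_numRadiusFun (hO : IsOperatorSpace O)
    {x₀ : Matrix (Fin m) (Fin m) X} {c : ℝ} (hc0 : 0 ≤ c) (hc : c < Wmax O m x₀) :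
    ∃ Φ : X →ₗ[ℂ] (HPow m ℂ →L[ℂ] HPow m ℂ),
      IsCompleteContraction O Φ ∧ c ≤ numRadiusFun Φ m x₀ := by
  have hm : m ≠ 0 := by
    rintro rfl
    rw [Subsingleton.elim x₀ 0, Wmax_zero] at hc
    exact hc.not_ge hc0
  obtain ⟨c', hcc', hc'⟩ := exists_between hc
  obtain ⟨f, p, hp1, hp, hfc, hf⟩ := exists_functionals hO hm hc'
  -- Chosen so that `c (1 + ε m) ≤ c'`, where `1 + ε m` will be the squared norm of the test vector.
  set ε := (c' - c) / (c * m + 1) with hε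
  have hden : 0 < c * m + 1 := by positivity
  have hεpos : 0 < ε := div_pos (sub_pos.2 hcc') hden
  have hεc : c * (1 + ε * m) ≤ c' := by
    have h1 : ε * (c * m + 1) = c' - c := div_mul_cancel₀ _ hden.ne'
    nlinarith
  obtain ⟨q, hqu, hq⟩ := exists_dominating_square hp hεpos
  have hdet := (Matrix.isUnit_iff_isUnit_det q).1 hqu
  have hqinv (v : Fin m → ℂ) : q.mulVec (q⁻¹.mulVec v) = v := by
    rw [Matrix.mulVec_mulVec, Matrix.mul_nonsing_inv q hdet, Matrix.one_mulVec]
  have hinvq (v : Fin m → ℂ) : q⁻¹.mulVec (q.mulVec v) = v := by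
    rw [Matrix.mulVec_mulVec, Matrix.nonsing_inv_mul q hdet, Matrix.one_mulVec]
  have hcol {r : ℕ} (ζ : HPow r (HPow m ℂ)) :
      p (columnMatrix q⁻¹ ζ * (columnMatrix q⁻¹ ζ).conjTranspose) ≤ ‖ζ‖ ^ 2 := by
    rw [columnMatrix_mul_conjTranspose, map_sum, PiLp.norm_sq_eq_of_L2]
    refine Finset.sum_le_sum fun s _ => ?_
    have h1 := hq (q⁻¹.mulVec (ζ s))
    rw [hqinv, ← EuclideanSpace.norm_sq_eq] at h1
    rw [h1]
    exact le_add_of_nonneg_right (by positivity)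
  refine ⟨formMap f q⁻¹, fun r y => ?_, ?_⟩
  · have hy := hO.isNorm.nonneg y
    have h := opNorm_le_two_mul (T := ampMap (formMap f q⁻¹) r y) (c := 1 / 2 * O r y)
      (by positivity) fun ξ η => by
        rw [inner_ampMap_formMap]
        refine (hf _ _ _ _).trans ?_
        rw [Matrix.conjTranspose_conjTranspose, map_add]
        gcongr
        · exact hcol η
        · exact hcol ξ
    rw [opNormFun_eq]
    linarith
  -- The components `q e_s` cancel the `q⁻¹` in the form: the coefficient at `ξ` is exactly `f x₀`,
  -- and `‖ξ‖² = p(1) + ε m`.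
  · let ξ : HPow m (HPow m ℂ) :=
      WithLp.toLp 2 fun s => WithLp.toLp 2 (q.mulVec (Pi.single s 1))
    have hξcol : columnMatrix q⁻¹ ξ = 1 := by
      ext i s
      rw [columnMatrix, Matrix.of_apply]
      simp only [ξ]
      rw [hinvq, Matrix.one_apply, Pi.single_apply]
      split_ifs <;> simp
    have hξnorm : ‖ξ‖ ^ 2 = 1 + ε * m := by
      have hsum : ∑ s : Fin m, Matrix.vecMulVec (star (Pi.single s 1 : Fin m → ℂ))
          (Pi.single s 1) = (1 : Matrix (Fin m) (Fin m) ℂ) := by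
        have h := columnMatrix_mul_conjTranspose q⁻¹ ξ
        rw [hξcol, Matrix.conjTranspose_one, mul_one] at h
        rw [h]
        refine Finset.sum_congr rfl fun s _ => ?_
        simp only [ξ]
        rw [hinvq]
      rw [PiLp.norm_sq_eq_of_L2]
      simp only [EuclideanSpace.norm_sq_eq, ξ, hq]
      rw [Finset.sum_add_distrib, ← map_sum, hsum, hp1]
      simp [sum_norm_sq_single, mul_comm]
    have h1 := norm_inner_le_numRadius (ampMap (formMap f q⁻¹) m x₀) ξ
    rw [inner_ampMap_formMap, hξcol, Matrix.conjTranspose_one, sandwich_one_one, hξnorm] at h1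
    have hpos : 0 < 1 + ε * m := by positivity
    rw [numRadiusFun_eq]
    exact le_of_mul_le_mul_right (hεc.trans (hfc.trans h1)) hpos

end Realization

/-! ### Direct sums and the maximal representation -/

section DirectSum

variable {ι : Type*} {G : ι → Type*} [∀ i, NormedAddCommGroup (G i)]
  [∀ i, InnerProductSpace ℂ (G i)]

omit [∀ i, InnerProductSpace ℂ (G i)] in
theorem hasSum_norm_sq (ζ : lp G 2) : HasSum (fun i => ‖ζ i‖ ^ 2) (‖ζ‖ ^ 2) := by
  simpa using lp.hasSum_norm (p := 2) (by simp) ζ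

theorem memℓp_two_map {T : ∀ i, G i →L[ℂ] G i} {C : ℝ} (hC : ∀ i, ‖T i‖ ≤ C) (ζ : lp G 2) :
    Memℓp (fun i => T i (ζ i)) 2 := by
  refine memℓp_gen ?_
  have h : Summable fun i => C ^ 2 * ‖ζ i‖ ^ 2 := (hasSum_norm_sq ζ).summable.mul_left _
  refine Summable.of_nonneg_of_le (fun i => by positivity) (fun i => ?_) h
  have h1 := (T i).le_of_opNorm_le (hC i) (ζ i)
  rw [← mul_pow]
  simpa using pow_le_pow_left₀ (norm_nonneg _) h1 2

/-- The direct sum of a uniformly bounded family of operators. -/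
def directSumOp (T : ∀ i, G i →L[ℂ] G i) {C : ℝ} (hC : ∀ i, ‖T i‖ ≤ C) : lp G 2 →L[ℂ] lp G 2 :=
  LinearMap.mkContinuous
    { toFun := fun ζ => ⟨fun i => T i (ζ i), memℓp_two_map hC ζ⟩
      map_add' := fun ζ θ => by ext i; exact map_add (T i) (ζ i) (θ i)
      map_smul' := fun c ζ => by ext i; exact map_smul (T i) c (ζ i) } |C| fun ζ => by
    -- The bound is `|C|` because an empty index type does not force `C` to be nonnegative.
    refine (pow_le_pow_iff_left₀ (norm_nonneg _) (by positivity) two_ne_zero).1 ?_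
    rw [mul_pow]
    refine hasSum_le (fun i => ?_) (hasSum_norm_sq _) ((hasSum_norm_sq ζ).mul_left _)
    rw [← mul_pow]
    have h1 := (T i).le_of_opNorm_le ((hC i).trans (le_abs_self C)) (ζ i)
    exact pow_le_pow_left₀ (norm_nonneg _) h1 2

@[simp] theorem directSumOp_apply (T : ∀ i, G i →L[ℂ] G i) {C : ℝ} (hC : ∀ i, ‖T i‖ ≤ C)
    (ζ : lp G 2) (i : ι) : directSumOp T hC ζ i = T i (ζ i) := rfl

variable {X : Type*} [AddCommGroup X] [Module ℂ X] {O : MatFun X}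

theorem IsCompleteContraction.norm_le {H : Type*} [NormedAddCommGroup H] [InnerProductSpace ℂ H]
    {Φ : X →ₗ[ℂ] (H →L[ℂ] H)} (hΦ : IsCompleteContraction O Φ) (x : X) :
    ‖Φ x‖ ≤ O 1 (Matrix.of fun _ _ => x) := by
  refine le_trans ?_ (hΦ 1 _)
  rw [opNormFun_eq]
  refine ContinuousLinearMap.opNorm_le_bound _ (ContinuousLinearMap.opNorm_nonneg _) fun ξ => ?_
  have h := (ampMap Φ 1 (Matrix.of fun _ _ => x)).le_opNorm (WithLp.toLp 2 fun _ => ξ)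
  have key (η : HPow 1 H) : ‖η‖ = ‖η 0‖ := by
    rw [← sq_eq_sq₀ (norm_nonneg _) (norm_nonneg _), PiLp.norm_sq_eq_of_L2, Fin.sum_univ_one]
  rw [key, key (WithLp.toLp 2 fun _ => ξ), ampMap_apply] at h
  simpa using h

/-- The direct sum of a family of complete contractions. -/
def directSumMap (Φ : ∀ i, X →ₗ[ℂ] (G i →L[ℂ] G i)) (hΦ : ∀ i, IsCompleteContraction O (Φ i)) :
    X →ₗ[ℂ] (lp G 2 →L[ℂ] lp G 2) where
  toFun x := directSumOp (fun i => Φ i x) fun i => (hΦ i).norm_le x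
  map_add' x y := by ext ζ i; simp
  map_smul' c x := by ext ζ i; simp

@[simp] theorem directSumMap_apply (Φ : ∀ i, X →ₗ[ℂ] (G i →L[ℂ] G i))
    (hΦ : ∀ i, IsCompleteContraction O (Φ i)) (x : X) (ζ : lp G 2) (i : ι) :
    directSumMap Φ hΦ x ζ i = Φ i x (ζ i) := rfl

theorem isCompleteContraction_directSumMap (hN : IsNormFamily O)
    (Φ : ∀ i, X →ₗ[ℂ] (G i →L[ℂ] G i)) (hΦ : ∀ i, IsCompleteContraction O (Φ i)) :
    IsCompleteContraction O (directSumMap Φ hΦ) := by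
  intro m x
  have hx := hN.nonneg x
  rw [opNormFun_eq]
  refine ContinuousLinearMap.opNorm_le_bound _ hx fun ζ => ?_
  refine (pow_le_pow_iff_left₀ (norm_nonneg _) (by positivity) two_ne_zero).1 ?_
  have hs (θ : HPow m (lp G 2)) : HasSum
      (fun i => ‖(WithLp.toLp 2 fun j => θ j i : HPow m (G i))‖ ^ 2) (‖θ‖ ^ 2) := by
    simp only [PiLp.norm_sq_eq_of_L2]
    exact hasSum_sum fun j _ => hasSum_norm_sq (θ j)
  rw [mul_pow]
  refine hasSum_le (fun i => ?_) (hs _) ((hs ζ).mul_left _)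
  have h : (WithLp.toLp 2 fun j => ampMap (directSumMap Φ hΦ) m x ζ j i : HPow m (G i)) =
      ampMap (Φ i) m x (WithLp.toLp 2 fun j => ζ j i) := by
    ext j
    simp only [ampMap_apply, lp.coeFn_sum]
    exact Finset.sum_apply _ _ _
  rw [h, ← mul_pow]
  exact pow_le_pow_left₀ (norm_nonneg _)
    (ContinuousLinearMap.le_of_opNorm_le _ (hΦ i m x) _) 2

theorem numRadiusFun_le_directSumMap (Φ : ∀ i, X →ₗ[ℂ] (G i →L[ℂ] G i))
    (hΦ : ∀ i, IsCompleteContraction O (Φ i)) (i : ι) {m : ℕ} (x : Matrix (Fin m) (Fin m) X) :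
    numRadiusFun (Φ i) m x ≤ numRadiusFun (directSumMap Φ hΦ) m x := by
  classical
  rw [numRadiusFun_eq, numRadiusFun_eq]
  refine numRadius_le (numRadius_nonneg _) fun ξ => ?_
  have h := norm_inner_le_numRadius (ampMap (directSumMap Φ hΦ) m x)
    (WithLp.toLp 2 fun j => lp.single 2 i (ξ j))
  rw [inner_ampMap, PiLp.norm_sq_eq_of_L2] at h
  simpa [lp.inner_single_left, ← inner_ampMap, lp.norm_single, ← PiLp.norm_sq_eq_of_L2] using h

/-- Only maps into the spaces `B(ℂᵏ)` are summed, so the index type stays in the universe of `X`.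
Isometry comes from corner blocks: `½ O(x) ≤ Wmax(corner x)`, which equals the numerical radius of
the represented corner, namely `½ ‖Φ(x)‖` for the amplified `Φ`. -/
theorem exists_maximal_representation {X : Type u} [AddCommGroup X] [Module ℂ X] {O : MatFun X}
    (hO : IsOperatorSpace O) :
    ∃ (H : Type u) (_ : NormedAddCommGroup H) (_ : InnerProductSpace ℂ H) (_ : CompleteSpace H)
      (Φ : X →ₗ[ℂ] (H →L[ℂ] H)), IsCompleteIsometry O Φ ∧ IsWCompleteIsometry (Wmax O) Φ := by
  let ι : Type u :=
    Σ k : ℕ, {φ : X →ₗ[ℂ] (HPow k ℂ →L[ℂ] HPow k ℂ) // IsCompleteContraction O φ}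
  let G : ι → Type := fun i => HPow i.1 ℂ
  let Φ : ∀ i : ι, X →ₗ[ℂ] (G i →L[ℂ] G i) := fun i => i.2.1
  have hΦ : ∀ i, IsCompleteContraction O (Φ i) := fun i => i.2.2
  have hcc := isCompleteContraction_directSumMap hO.isNorm Φ hΦ
  have hW : IsWCompleteIsometry (Wmax O) (directSumMap Φ hΦ) := by
    intro m x
    refine le_antisymm (numRadiusFun_le_Wmax hO.isNorm hcc x) (le_of_forall_lt fun c hc => ?_)
    obtain ⟨c', hcc', hc'⟩ := exists_between hc
    rcases lt_or_ge c' 0 with h0 | h0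
    · exact hcc'.trans (h0.trans_le (numRadius_nonneg _))
    · obtain ⟨φ, hφ, hle⟩ := exists_isCompleteContraction_le_numRadiusFun hO h0 hc'
      exact hcc'.trans_le (hle.trans
        (numRadiusFun_le_directSumMap Φ hΦ (⟨m, φ, hφ⟩ : ι) x))
  refine ⟨lp G 2, inferInstance, inferInstance, inferInstance, directSumMap Φ hΦ, ?_, hW⟩
  intro m x
  refine le_antisymm (hcc m x) ?_
  have h1 := numRadiusFun_cornerBlock (directSumMap Φ hΦ) x
  rw [hW] at h1
  linarith [half_le_Wmax_cornerBlock hO x]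

end DirectSum

/-! ### The two families of affiliated norms -/

section Families

variable {X : Type*} [AddCommGroup X] [Module ℂ X] {O : MatFun X}
  {H : Type*} [NormedAddCommGroup H] [InnerProductSpace ℂ H] {Φ : X →ₗ[ℂ] (H →L[ℂ] H)}

theorem isCompleteIsometry_shiftMat (hΦ : IsCompleteIsometry O Φ) {n : ℕ} (hn : 2 ≤ n) {t : ℝ}
    (ht : t ∈ Set.Icc (0 : ℝ) 1) : IsCompleteIsometry O (tensorMap Φ (shiftMat n t)) :=
  isCompleteIsometry_tensorMap hΦ (norm_shiftMat hn ht) (sum_norm_sq_single ⟨1, by omega⟩)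
    (by rw [shiftMat_mulVec_single hn t, sum_norm_sq_single])

theorem isCompleteIsometry_cornerMat (hΦ : IsCompleteIsometry O Φ) {t : ℝ}
    (ht : t ∈ Set.Icc (0 : ℝ) 1) : IsCompleteIsometry O (tensorMap Φ (cornerMat t)) :=
  isCompleteIsometry_tensorMap hΦ (norm_cornerMat ht) (sum_norm_sq_single 1)
    (sum_norm_sq_cornerMat_mulVec_single ht)

theorem isAffiliated_shiftMat (hO : IsOperatorSpace O) (hΦ : IsCompleteIsometry O Φ) {n : ℕ}
    (hn : 2 ≤ n) {t : ℝ} (ht : t ∈ Set.Icc (0 : ℝ) 1) :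
    IsAffiliated O (tensorNorm Φ (shiftMat n t)) :=
  isAffiliated_numRadiusFun hO (isCompleteIsometry_shiftMat hΦ hn ht)

theorem isAffiliated_cornerMat (hO : IsOperatorSpace O) (hΦ : IsCompleteIsometry O Φ) {t : ℝ}
    (ht : t ∈ Set.Icc (0 : ℝ) 1) : IsAffiliated O (tensorNorm Φ (cornerMat t)) :=
  isAffiliated_numRadiusFun hO (isCompleteIsometry_cornerMat hΦ ht)

theorem tensorNorm_shiftMat_zero (hΦ : IsCompleteIsometry O Φ) {n : ℕ} (hn : 2 ≤ n) :
    tensorNorm Φ (shiftMat n 0) = Wmin O :=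
  tensorNorm_single_eq_Wmin hΦ (by simp) (shiftMat_zero hn)
    (isCompleteIsometry_shiftMat hΦ hn ⟨le_rfl, zero_le_one⟩)

theorem tensorNorm_cornerMat_zero (hΦ : IsCompleteIsometry O Φ) :
    tensorNorm Φ (cornerMat 0) = Wmin O :=
  tensorNorm_single_eq_Wmin hΦ zero_ne_one cornerMat_zero
    (isCompleteIsometry_cornerMat hΦ ⟨le_rfl, zero_le_one⟩)

theorem cos_mul_Wmax_le (hW : IsWCompleteIsometry (Wmax O) Φ) {n : ℕ} (hn : 1 ≤ n) {m : ℕ}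
    (x : Matrix (Fin m) (Fin m) X) :
    Real.cos (Real.pi / (n + 1)) * Wmax O m x ≤ tensorNorm Φ (shiftMat n 1) m x := by
  rw [← hW m x, tensorNorm_eq]
  exact cos_mul_numRadius_le hn _

/-- The reason for `n ≥ 3`: for `n = 2` the cosine equals `1 / 2`, and the lower bound at `t = 1`
would not separate the endpoints. -/
theorem half_lt_cos {n : ℕ} (hn : 3 ≤ n) : 1 / 2 < Real.cos (Real.pi / (n + 1)) := by
  rw [← Real.cos_pi_div_three]
  have h : (3 : ℝ) ≤ n := by exact_mod_cast hn
  have hpi := Real.pi_pos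
  apply Real.cos_lt_cos_of_nonneg_of_le_pi (by positivity) (by linarith)
  exact div_lt_div_of_pos_left hpi (by norm_num) (by linarith)

theorem not_countable_shiftMat (hO : IsOperatorSpace O) (hΦ : IsCompleteIsometry O Φ)
    (hW : IsWCompleteIsometry (Wmax O) Φ) {n : ℕ} (hn : 3 ≤ n) [Nontrivial X] :
    ¬ ((fun t : ℝ => tensorNorm Φ (shiftMat n t)) '' Set.Icc (0 : ℝ) 1).Countable := by
  obtain ⟨x, hx⟩ := exists_fin_one_pos hO
  refine not_countable_image_Icc (x := x)
    (continuous_tensorNorm (continuous_shiftMat n) Φ x).continuousOn ?_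
  have h1 := cos_mul_Wmax_le hW (by omega : 1 ≤ n) x
  have h2 := half_lt_cos hn
  have h3 := le_Wmax_fin_one hO x
  rw [tensorNorm_shiftMat_zero hΦ (by omega), Wmin]
  calc 1 / 2 * O 1 x < Real.cos (Real.pi / (n + 1)) * O 1 x := by gcongr
    _ ≤ Real.cos (Real.pi / (n + 1)) * Wmax O 1 x := by gcongr
    _ ≤ _ := h1

theorem not_countable_cornerMat (hO : IsOperatorSpace O) (hΦ : IsCompleteIsometry O Φ)
    (hW : IsWCompleteIsometry (Wmax O) Φ) [Nontrivial X] :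
    ¬ ((fun t : ℝ => tensorNorm Φ (cornerMat t)) '' Set.Icc (0 : ℝ) 1).Countable := by
  obtain ⟨x, hx⟩ := exists_fin_one_pos hO
  refine not_countable_image_Icc (x := x)
    (continuous_tensorNorm continuous_cornerMat Φ x).continuousOn ?_
  -- At `t = 1` the matrix is a diagonal unit, so the value is at least `Wmax x ≥ O x`, while at `t
  -- = 0` it is `½ O x`.
  have h1 := numRadius_le_cornerMat_one (ampMap Φ 1 x)
  rw [← numRadiusFun_eq, hW, ← tensorNorm_eq] at h1
  have h3 := le_Wmax_fin_one hO x
  rw [tensorNorm_cornerMat_zero hΦ, Wmin]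
  linarith

end Families

end NumRad

end

theorem mainTheorem8 {X : Type u} [AddCommGroup X] [Module ℂ X]
    (O : NumRad.MatFun X) (hO : NumRad.IsOperatorSpace O) (n : ℕ) (hn : 3 ≤ n) :
    -- existence of the representation of the maximal numerical radius norm
    (∃ (H : Type u) (_ : NormedAddCommGroup H) (_ : InnerProductSpace ℂ H) (_ : CompleteSpace H)
      (Φ : X →ₗ[ℂ] (H →L[ℂ] H)),
      NumRad.IsCompleteIsometry O Φ ∧ NumRad.IsWCompleteIsometry (NumRad.Wmax O) Φ) ∧
    -- the family obtained from any such representation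
    (∀ (H : Type v) [NormedAddCommGroup H] [InnerProductSpace ℂ H] [CompleteSpace H]
      (Φ : X →ₗ[ℂ] (H →L[ℂ] H)),
      NumRad.IsCompleteIsometry O Φ → NumRad.IsWCompleteIsometry (NumRad.Wmax O) Φ →
      (∀ t ∈ Set.Icc (0 : ℝ) 1,
        ‖NumRad.shiftMat n t‖ = 1 ∧
        NumRad.IsCompleteIsometry O (H := NumRad.HPow n H)
          (NumRad.tensorMap Φ (NumRad.shiftMat n t)) ∧
        NumRad.IsAffiliated O (NumRad.tensorNorm Φ (NumRad.shiftMat n t))) ∧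
      NumRad.tensorNorm Φ (NumRad.shiftMat n 0) = NumRad.Wmin O ∧
      (∀ (m : ℕ) (x : Matrix (Fin m) (Fin m) X),
        Real.cos (Real.pi / (n + 1)) * NumRad.Wmax O m x
            ≤ NumRad.tensorNorm Φ (NumRad.shiftMat n 1) m x ∧
        NumRad.tensorNorm Φ (NumRad.shiftMat n 1) m x ≤ NumRad.Wmax O m x) ∧
      (∀ (m : ℕ) (x : Matrix (Fin m) (Fin m) X),
        ContinuousOn (fun t : ℝ => NumRad.tensorNorm Φ (NumRad.shiftMat n t) m x)
          (Set.Icc (0 : ℝ) 1)) ∧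
      (Nontrivial X →
        ¬ ((fun t : ℝ => NumRad.tensorNorm Φ (NumRad.shiftMat n t)) ''
            Set.Icc (0 : ℝ) 1).Countable) ∧
      -- the same for the second family, built from a path of 2 by 2 matrices
      (∀ t ∈ Set.Icc (0 : ℝ) 1,
        NumRad.IsAffiliated O (NumRad.tensorNorm Φ (NumRad.cornerMat t))) ∧
      (∀ (m : ℕ) (x : Matrix (Fin m) (Fin m) X),
        ContinuousOn (fun t : ℝ => NumRad.tensorNorm Φ (NumRad.cornerMat t) m x)
          (Set.Icc (0 : ℝ) 1)) ∧
      (Nontrivial X →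
        ¬ ((fun t : ℝ => NumRad.tensorNorm Φ (NumRad.cornerMat t)) ''
            Set.Icc (0 : ℝ) 1).Countable)) ∧
    -- there are uncountably many affiliated numerical radius norms
    (Nontrivial X → ¬ {W : NumRad.MatFun X | NumRad.IsAffiliated O W}.Countable) := by
  have hn2 : 2 ≤ n := by omega
  refine ⟨NumRad.exists_maximal_representation hO, ?_, ?_⟩
  · intro H _ _ _ Φ hΦ hW
    refine ⟨fun t ht => ⟨NumRad.norm_shiftMat hn2 ht,
        NumRad.isCompleteIsometry_shiftMat hΦ hn2 ht, NumRad.isAffiliated_shiftMat hO hΦ hn2 ht⟩,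
      NumRad.tensorNorm_shiftMat_zero hΦ hn2, fun m x => ⟨?_, ?_⟩, fun m x => ?_, ?_,
      fun t ht => NumRad.isAffiliated_cornerMat hO hΦ ht, fun m x => ?_, ?_⟩
    · exact NumRad.cos_mul_Wmax_le hW (by omega) x
    · exact NumRad.numRadiusFun_le_Wmax hO.isNorm (NumRad.isCompleteIsometry_shiftMat hΦ hn2
        ⟨zero_le_one, le_rfl⟩).isCompleteContraction x
    · exact (NumRad.continuous_tensorNorm (NumRad.continuous_shiftMat n) Φ x).continuousOn
    · intro _
      exact NumRad.not_countable_shiftMat hO hΦ hW hn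
    · exact (NumRad.continuous_tensorNorm NumRad.continuous_cornerMat Φ x).continuousOn
    · intro _
      exact NumRad.not_countable_cornerMat hO hΦ hW
  · intro _ hc
    -- No representation is fixed in this last claim, so one is constructed; its shift path already
    -- supplies uncountably many affiliated norms.
    obtain ⟨H, _, _, _, Φ, hΦ, hW⟩ := NumRad.exists_maximal_representation hO
    refine NumRad.not_countable_shiftMat hO hΦ hW hn (hc.mono ?_)
    rintro _ ⟨t, ht, rfl⟩
    exact NumRad.isAffiliated_shiftMat hO hΦ hn2 ht
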